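/- Consider the acoustic equations in the plane with unit density and bulk modulus, $$q_t+\begin{bmatrix}0&1&0\\1&0&0\\0&0&0\end{bmatrix}q_{x_1}+\begin{bmatrix}0&0&1\\0&0&0\\1&0&0\end{bmatrix}q_{x_2}=0,\qquad q=(p,u,v),\quad t>0,\ x\in\mathbb R^2,$$ with initial data $q(0,\cdot)=(p_0,0,0)$, where $p_0(x)=\cos(\pi\|x\|_2^2/2)$ if $\|x\|_2<1$ and $p_0(x)=0$ otherwise. Let $q$ be the exact solution, that is, the continuous weak solution on $[0,\infty)\times\mathbb R^2$ which is integrable over $[0,T]\times\mathbb R^2$ for every $T$. For a unit vector $\omega$ and $s\in\mathbb R$ let $\hat p_0(\omega,s)=\int_{x\cdot\omega=s}p_0\,dm$ be the Radon transform of $p_0$ (which does not depend on $\omega$), and let $$\hat q(t,\omega,s)=\tfrac12\big(\hat p_0(\omega,s-t)\,(1,\omega_1,\omega_2)+\hat p_0(\omega,s+t)\,(1,-\omega_1,-\omega_2)\big)$$ be the d'Alembert solution on the Radon side. For $b>0$ let $q_h$ be the approximate solution obtained with one-dimensional extrapolation boundaries at $s=\pm b$ on the Radon side, that is, $$q_h(t,x)=\frac1{c_2}\,\mathcal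 R^\#\Big[H_s\,\chi_{(-b,b)}(s)\,\frac{\partial}{\partial s}\hat q(t,\omega,s)\Big](x),\qquad c_n=(4\pi)^{(n-1)/2}\,\frac{\Gamma(n/2)}{\Gamma(1/2)},$$ where $\mathcal R^\#\psi(x)=\int_{S^1}\psi(\omega,\omega\cdot x)\,dS(\omega)$ with the rotation-invariant measure of total mass one on $S^1$, and $H_sf(s)=\frac1\pi\,\mathrm{p.v.}\!\int\frac{f(z)}{s-z}\,dz$. Then for every $b>0$, every $t$ with $(-1+t,1+t)\subset(b,\infty)$, every $x\in\mathbb R^2$ with $t-\|x\|_2-1\ne0$ and every unit vector $\omega$, $$\|q(t,x)-q_h(t,x)\|_1\le\frac{2\sqrt6\,\pi}{c_2\,\big|t-\|x\|_2-1\big|}\int_{\mathbb R}\Big|\frac{d\hat p_0}{dz}(\omega,z)\Big|\,dz ,$$ where $\|\cdot\|_1$ is the $\ell^1$-norm on $\mathbb R^3$. Consequently the error decays like $O(1/t)$, uniformly on bounded sets: for every $b>0$ and $R$ there are $C$ and $T>0$ such that $\|q(t,x)-q_h(t,x)\|_1\le C/t$ for all $t\ge T$ and all $x$ with $\|x\|_2\le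 R$. -/

import Mathlib

open MeasureTheory Filter Topology Set
open scoped RealInnerProductSpace

noncomputable section

/-- The Euclidean plane. -/
abbrev Plane : Type := EuclideanSpace ℝ (Fin 2)

/-- Counterclockwise rotation by a right angle. -/
def rot (ω : Plane) : Plane := !₂[-ω 1, ω 0]

/-- The Radon transform in the plane: for a unit vector `ω`, the integral of `φ` over the line
`{x | ⟪x, ω⟫ = s}`, which is parametrized by arc length as `τ ↦ s • ω + τ • rot ω`. -/
def radon (φ : Plane → ℝ) (ω : Plane) (s : ℝ) : ℝ :=
  ∫ τ : ℝ, φ (s • ω + τ • rot ω)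

/-- The back-projection in the plane: the mean over the unit circle (with respect to the
rotation-invariant probability measure) of `ψ ω ⟪ω, x⟫`. -/
def backProjection (ψ : Plane → ℝ → ℝ) (x : Plane) : ℝ :=
  ⨍ ω : Metric.sphere (0 : Plane) 1, ψ ω ⟪(ω : Plane), x⟫ ∂((volume : Measure Plane).toSphere)

/-- The Hilbert transform `(1 / π) p.v. ∫ f z / (s - z) dz`. -/
def hilbertTransform (f : ℝ → ℝ) (s : ℝ) : ℝ :=
  limUnder (𝓝[>] (0 : ℝ)) fun ε : ℝ => (1 / Real.pi) * ∫ z in {z : ℝ | ε < |z - s|}, f z / (s - z)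

/-- The constant `c_n` of the Radon inversion formula. -/
def radonConst (n : ℕ) : ℝ :=
  (4 * Real.pi) ^ (((n : ℝ) - 1) / 2) * Real.Gamma ((n : ℝ) / 2) / Real.Gamma (1 / 2)

/-- The coefficient matrices of the two-dimensional acoustic equations for `(p, u, v)`, with bulk
modulus `K₀` and density `ρ₀`: index `0` belongs to `∂/∂x₁` and index `1` to `∂/∂x₂`. -/
def acousticMatrix (K₀ ρ₀ : ℝ) : Fin 2 → Matrix (Fin 3) (Fin 3) ℝ :=
  ![!![0, K₀, 0; 1 / ρ₀, 0, 0; 0, 0, 0],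
    !![0, 0, K₀; 0, 0, 0; 1 / ρ₀, 0, 0]]

/-- `q = (p, u, v)` is a continuous weak solution on `[0, ∞) × ℝ²`, integrable over
`[0, T] × ℝ²` for every `T`, of the acoustic equations
`q_t + A₁ q_{x₁} + A₂ q_{x₂} = 0` with initial value `q₀` at time `0`. -/
structure IsAcousticSolution (K₀ ρ₀ : ℝ) (q₀ : Plane → Fin 3 → ℝ)
    (q : ℝ → Plane → Fin 3 → ℝ) : Prop where
  continuousOn : ContinuousOn (fun z : ℝ × Plane => q z.1 z.2) (Ici 0 ×ˢ univ)
  integrableOn : ∀ T : ℝ, IntegrableOn (fun z : ℝ × Plane => q z.1 z.2) (Icc 0 T ×ˢ univ)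
  weak : ∀ φ : ℝ × Plane → ℝ, ContDiff ℝ (⊤ : ℕ∞) φ → HasCompactSupport φ →
    (∫ z in (Ioi 0 ×ˢ univ : Set (ℝ × Plane)),
        (fderiv ℝ φ z (1, 0) • q z.1 z.2 +
          ∑ j : Fin 2, fderiv ℝ φ z (0, EuclideanSpace.single j 1) •
            (acousticMatrix K₀ ρ₀ j).mulVec (q z.1 z.2))) +
      ∫ x : Plane, φ (0, x) • q₀ x = 0

/-- The cosine hump. -/
def cosHump (x : Plane) : ℝ :=
  if x 0 ^ 2 + x 1 ^ 2 < 1 then Real.cos (Real.pi * (x 0 ^ 2 + x 1 ^ 2) / 2) else 0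

/-- The initial state: cosine hump pressure, zero velocity. -/
def cosHumpState (x : Plane) : Fin 3 → ℝ := ![cosHump x, 0, 0]

/-- The solution on the Radon side for `K₀ = ρ₀ = 1`: the d'Alembert solution, for each direction
`ω`, of the one-dimensional problem whose initial pressure is the Radon transform of the cosine
hump. -/
def transformedSolution (t : ℝ) (ω : Plane) (s : ℝ) : Fin 3 → ℝ :=
  (1 / 2 : ℝ) • (radon cosHump ω (s - t) • ![1, ω 0, ω 1] +
    radon cosHump ω (s + t) • ![1, -ω 0, -ω 1])

/-- The approximate solution `(1 / c₂) R^# H_s χ_{(-b, b)} (d/ds) q̂` obtained with extrapolation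
boundaries at `s = ± b` on the Radon side. -/
def truncatedSolution (b t : ℝ) (x : Plane) (i : Fin 3) : ℝ :=
  1 / radonConst 2 * backProjection (fun ω s => hilbertTransform
    ((Ioo (-b) b).indicator (deriv fun z : ℝ => transformedSolution t ω z i)) s) x

end

/-!
Once `b ≤ t - 1`, both d'Alembert waves on the Radon side have left the interval `(-b, b)`, so the
truncated solution is zero (`truncatedSolution_eq_zero`) and the claim is a decay estimate for the
solution `q` itself. Since `q` is only assumed to be a continuous integrable weak solution, it
first has to be identified, and this is done by testing with plane waves.

*Plane waves.* Integrability allows test functions that are merely bounded with bounded gradient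
(`IsAcousticSolution.weak_of_bounded`). A travelling wave `w (⟪ω, x⟫ - t)` with polarization
`(1, ω)` and a standing wave `w ⟪ω, x⟫` with polarization `(0, ω^⊥)` solve the adjoint equations, so
the corresponding moments of `q (t, ·)` are those of the data for almost every `t`
(`IsAcousticSolution.ae_forall_planeMoment`).

*Inversion.* For the profile `w s = Re (ε + i s)⁻²` the average of `w ⟪ω, y⟫` over all directions
is the Poisson kernel `ε / (ε² + |y|²) ^ (3 / 2)` up to a constant (`integral_planeKernel_cos`).
Averaging the moments with the weights `1`, `ω₁`, `ω₂` therefore gives the Poisson means of the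
three components of `q (t, ·)`, because all mixed terms are odd in `ω`; they tend to `q (t, x)` as
`ε → 0`.

*Estimate.* Slicing turns the moments of the hump into integrals of its Radon transform `g`, and an
integration by parts into integrals of `g'` against `s / (ε² + s²) = -Im (ε + i s)⁻¹`. The
integral `A` of `(c - i r cos φ)⁻¹` over a period satisfies `A² (c² + r²) = (2π)²`
(`circleResolvent_sq`), and it dominates the first cosine moment
(`norm_integral_cos_mul_inv_circleDenom_le`). Hence each component of `q (t, x)` is at most
`(1 / 2π) ∫ |g' z| / √(|t + z + r| |t + z - r|) dz` with `r = ‖x‖`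
(`IsAcousticSolution.ae_abs_le`). If `r < t - 1`, both factors are at least `t - r - 1`. If
`r > t - 1`, the singularity is integrable, and `|g'| ≤ 2π` together with
`∫ |g'| ≥ 2 g 0 ≥ 8 / 3` gives the same form of bound.
-/

/-! ### The weak formulation and conserved quantities -/

/-- The integrand `ℓ (1, 0) v + ∑ⱼ ℓ (0, eⱼ) Aⱼ v` of the weak formulation, for a state `v` and a
space-time gradient `ℓ` of the test function. -/
noncomputable def acousticPairing (K₀ ρ₀ : ℝ) (ℓ : ℝ × Plane →L[ℝ] ℝ) (v : Fin 3 → ℝ) :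
    Fin 3 → ℝ :=
  ℓ (1, 0) • v + ∑ j : Fin 2, ℓ (0, EuclideanSpace.single j 1) • (acousticMatrix K₀ ρ₀ j).mulVec v

lemma exists_norm_acousticPairing_le (K₀ ρ₀ : ℝ) :
    ∃ C : ℝ, 0 ≤ C ∧ ∀ ℓ v, ‖acousticPairing K₀ ρ₀ ℓ v‖ ≤ C * ‖ℓ‖ * ‖v‖ := by
  let A : Fin 2 → ((Fin 3 → ℝ) →L[ℝ] (Fin 3 → ℝ)) := fun j =>
    LinearMap.toContinuousLinearMap (Matrix.mulVecLin (acousticMatrix K₀ ρ₀ j))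
  have hA : ∀ j v, (acousticMatrix K₀ ρ₀ j).mulVec v = A j v := fun j v => rfl
  refine ⟨1 + ∑ j, ‖A j‖, by positivity, fun ℓ v => ?_⟩
  have h1 : ‖ℓ (1, 0)‖ ≤ ‖ℓ‖ := by
    simpa [Prod.norm_def] using ℓ.le_opNorm (1, 0)
  have h2 : ∀ j : Fin 2, ‖ℓ (0, EuclideanSpace.single j 1)‖ ≤ ‖ℓ‖ := fun j => by
    simpa [Prod.norm_def] using ℓ.le_opNorm (0, EuclideanSpace.single j 1)
  calc ‖acousticPairing K₀ ρ₀ ℓ v‖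
      ≤ ‖ℓ (1, 0)‖ * ‖v‖ + ∑ j : Fin 2, ‖ℓ (0, EuclideanSpace.single j 1)‖ * (‖A j‖ * ‖v‖) := by
        refine (norm_add_le _ _).trans (add_le_add (norm_smul_le _ _) ?_)
        refine (norm_sum_le _ _).trans (Finset.sum_le_sum fun j _ => ?_)
        rw [hA]
        exact (norm_smul_le _ _).trans
          (mul_le_mul_of_nonneg_left ((A j).le_opNorm v) (norm_nonneg _))
    _ ≤ ‖ℓ‖ * ‖v‖ + ∑ j : Fin 2, ‖ℓ‖ * (‖A j‖ * ‖v‖) := by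
        gcongr with j
        exact h2 j
    _ = (1 + ∑ j, ‖A j‖) * ‖ℓ‖ * ‖v‖ := by
        rw [← Finset.mul_sum, ← Finset.sum_mul]; ring

lemma continuous_acousticPairing (K₀ ρ₀ : ℝ) :
    Continuous fun z : (ℝ × Plane →L[ℝ] ℝ) × (Fin 3 → ℝ) => acousticPairing K₀ ρ₀ z.1 z.2 := by
  unfold acousticPairing
  refine Continuous.add ?_ (continuous_finsetSum _ fun j _ => ?_)
  · exact (continuous_fst.clm_apply continuous_const).smul continuous_snd
  · refine (continuous_fst.clm_apply continuous_const).smul ?_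
    exact Continuous.matrix_mulVec continuous_const continuous_snd

lemma tendsto_acousticPairing {K₀ ρ₀ : ℝ} {ι : Type*} {l : Filter ι}
    {L : ι → ℝ × Plane →L[ℝ] ℝ} {ℓ : ℝ × Plane →L[ℝ] ℝ} (h : Tendsto L l (𝓝 ℓ)) (v : Fin 3 → ℝ) :
    Tendsto (fun n => acousticPairing K₀ ρ₀ (L n) v) l (𝓝 (acousticPairing K₀ ρ₀ ℓ v)) := by
  have h1 : Continuous fun ℓ => acousticPairing K₀ ρ₀ ℓ v :=
    (continuous_acousticPairing K₀ ρ₀).comp (continuous_id.prodMk continuous_const)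
  exact (h1.tendsto ℓ).comp h

lemma acousticPairing_add (K₀ ρ₀ : ℝ) (ℓ ℓ' : ℝ × Plane →L[ℝ] ℝ) (v : Fin 3 → ℝ) :
    acousticPairing K₀ ρ₀ (ℓ + ℓ') v = acousticPairing K₀ ρ₀ ℓ v + acousticPairing K₀ ρ₀ ℓ' v := by
  simp only [acousticPairing, add_apply, add_smul, Finset.sum_add_distrib]
  abel

lemma acousticPairing_smul (K₀ ρ₀ c : ℝ) (ℓ : ℝ × Plane →L[ℝ] ℝ) (v : Fin 3 → ℝ) :
    acousticPairing K₀ ρ₀ (c • ℓ) v = c • acousticPairing K₀ ρ₀ ℓ v := by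
  simp only [acousticPairing, smul_apply, smul_eq_mul, mul_smul, smul_add,
    Finset.smul_sum]

section
variable {K₀ ρ₀ : ℝ} {q₀ : Plane → Fin 3 → ℝ} {q : ℝ → Plane → Fin 3 → ℝ}

lemma measurableSet_Ioi_prod_univ : MeasurableSet (Ioi 0 ×ˢ univ : Set (ℝ × Plane)) :=
  measurableSet_Ioi.prod MeasurableSet.univ

lemma IsAcousticSolution.aestronglyMeasurable_pairing (hq : IsAcousticSolution K₀ ρ₀ q₀ q)
    {φ : ℝ × Plane → ℝ} (hφ : ContDiff ℝ (⊤ : ℕ∞) φ) :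
    AEStronglyMeasurable (fun z : ℝ × Plane => acousticPairing K₀ ρ₀ (fderiv ℝ φ z) (q z.1 z.2))
      (volume.restrict (Ioi 0 ×ˢ univ)) := by
  refine ContinuousOn.aestronglyMeasurable ?_ measurableSet_Ioi_prod_univ
  have h1 : ContinuousOn (fun z : ℝ × Plane => q z.1 z.2) (Ioi 0 ×ˢ univ) :=
    hq.continuousOn.mono (prod_mono Ioi_subset_Ici_self subset_rfl)
  exact (continuous_acousticPairing K₀ ρ₀).comp_continuousOn
    ((hφ.continuous_fderiv (by simp)).continuousOn.prodMk h1)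

lemma fderiv_eq_zero_of_time_gt {φ : ℝ × Plane → ℝ} {T : ℝ} (hT : ∀ z, T ≤ z.1 → φ z = 0)
    {z : ℝ × Plane} (hz : T < z.1) : fderiv ℝ φ z = 0 := by
  have : φ =ᶠ[𝓝 z] fun _ => 0 := by
    filter_upwards [(isOpen_lt continuous_const continuous_fst).mem_nhds hz] with y hy
    exact hT y (le_of_lt hy)
  rw [this.fderiv_eq]; simp

lemma IsAcousticSolution.integrable_majorant (hq : IsAcousticSolution K₀ ρ₀ q₀ q) (T C : ℝ) :
    Integrable (fun z : ℝ × Plane =>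
      C * (Icc 0 T ×ˢ univ).indicator (fun z : ℝ × Plane => ‖q z.1 z.2‖) z)
      (volume.restrict (Ioi 0 ×ˢ univ)) :=
  (((integrable_indicator_iff (measurableSet_Icc.prod MeasurableSet.univ)).mpr
    (Integrable.norm (hq.integrableOn T))).const_mul C).restrict

/-- A continuous integrable weak solution may be tested with smooth functions that are not
compactly supported in space, as long as they are bounded with bounded gradient. -/
lemma IsAcousticSolution.weak_of_bounded (hq : IsAcousticSolution K₀ ρ₀ q₀ q)
    (hq₀ : Integrable q₀) {φ : ℝ × Plane → ℝ} (hφ : ContDiff ℝ (⊤ : ℕ∞) φ) {M T : ℝ}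
    (hM : ∀ z, |φ z| ≤ M) (hM' : ∀ z, ‖fderiv ℝ φ z‖ ≤ M) (hT : ∀ z, T ≤ z.1 → φ z = 0) :
    Integrable (fun z : ℝ × Plane => acousticPairing K₀ ρ₀ (fderiv ℝ φ z) (q z.1 z.2))
      (volume.restrict (Ioi 0 ×ˢ univ)) ∧
    (∫ z in (Ioi 0 ×ˢ univ : Set (ℝ × Plane)),
        acousticPairing K₀ ρ₀ (fderiv ℝ φ z) (q z.1 z.2)) +
      ∫ x : Plane, φ (0, x) • q₀ x = 0 := by
  obtain ⟨C, hC, hpair⟩ := exists_norm_acousticPairing_le K₀ ρ₀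
  have hM0 : 0 ≤ M := (abs_nonneg _).trans (hM 0)
  -- a gradient bound for functions vanishing after time `T` gives an integrable majorant
  have hbound : ∀ (f : ℝ × Plane → ℝ) (B : ℝ), 0 ≤ B → (∀ z, T ≤ z.1 → f z = 0) →
      (∀ z, ‖fderiv ℝ f z‖ ≤ B) → ∀ᵐ z ∂(volume.restrict (Ioi 0 ×ˢ univ : Set (ℝ × Plane))),
      ‖acousticPairing K₀ ρ₀ (fderiv ℝ f z) (q z.1 z.2)‖ ≤
        C * B * (Icc 0 T ×ˢ univ).indicator (fun z : ℝ × Plane => ‖q z.1 z.2‖) z := by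
    intro f B hB hf hfB
    filter_upwards [ae_restrict_mem measurableSet_Ioi_prod_univ] with z hz
    by_cases hzT : z.1 ≤ T
    · rw [indicator_of_mem (show z ∈ Icc 0 T ×ˢ univ from ⟨⟨le_of_lt hz.1, hzT⟩, trivial⟩)]
      refine (hpair _ _).trans ?_
      gcongr
      exact hfB z
    · rw [fderiv_eq_zero_of_time_gt hf (not_le.mp hzT), indicator_of_notMem (fun h => hzT h.1.2)]
      simpa using hpair 0 (q z.1 z.2)
  refine ⟨(hq.integrable_majorant T (C * M)).mono' (hq.aestronglyMeasurable_pairing hφ)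
    (hbound φ M hM0 hT hM'), ?_⟩
  let η : ContDiffBump (0 : ℝ × Plane) := ⟨1, 2, one_pos, one_lt_two⟩
  have hη : ContDiff ℝ (⊤ : ℕ∞) η := η.contDiff
  obtain ⟨D, hD⟩ := (η.hasCompactSupport.fderiv (𝕜 := ℝ)).exists_bound_of_continuous
    (hη.continuous_fderiv (by simp))
  have hD0 : 0 ≤ D := (norm_nonneg _).trans (hD 0)
  let s : ℕ → ℝ := fun n => 1 / ((n : ℝ) + 1)
  have hs0 : ∀ n, 0 < s n := fun n => by positivity
  have hs1 : ∀ n, s n ≤ 1 := fun n => by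
    have : (0 : ℝ) ≤ n := n.cast_nonneg
    simp only [s]; rw [div_le_one (by positivity)]; linarith
  have hslim : Tendsto s atTop (𝓝 0) := tendsto_one_div_add_atTop_nhds_zero_nat
  let e : ℕ → ℝ × Plane → ℝ := fun n z => η (s n • z)
  have he : ∀ n, ContDiff ℝ (⊤ : ℕ∞) (e n) := fun n => hη.comp (contDiff_const_smul (s n))
  have he1 : ∀ n z, |e n z| ≤ 1 := fun n z => by
    rw [abs_of_nonneg η.nonneg]; exact η.le_one
  have hefd : ∀ n z, fderiv ℝ (e n) z = s n • fderiv ℝ η (s n • z) := fun n z => by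
    have h := ((hη.differentiable (by simp)) (s n • z)).hasFDerivAt.comp z
      ((hasFDerivAt_id (𝕜 := ℝ) z).const_smul (s n))
    have h' : HasFDerivAt (e n) _ z := h
    rw [h'.fderiv]; ext <;> simp
  have hefd' : ∀ n z, ‖fderiv ℝ (e n) z‖ ≤ s n * D := fun n z => by
    rw [hefd, norm_smul, Real.norm_of_nonneg (hs0 n).le]
    exact mul_le_mul_of_nonneg_left (hD _) (hs0 n).le
  have hecpt : ∀ n, HasCompactSupport (e n) := fun n =>
    η.hasCompactSupport.comp_homeomorph (Homeomorph.smulOfNeZero (s n) (hs0 n).ne')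
  have helim : ∀ z, Tendsto (fun n => e n z) atTop (𝓝 1) := fun z => by
    have h1 : Tendsto (fun n => s n • z) atTop (𝓝 0) := by simpa using hslim.smul_const z
    have h2 := (hη.continuous.tendsto 0).comp h1
    rwa [η.one_of_mem_closedBall (by simp [η])] at h2
  let f : ℕ → ℝ × Plane → ℝ := fun n z => φ z * e n z
  have hf : ∀ n, ContDiff ℝ (⊤ : ℕ∞) (f n) := fun n => hφ.mul (he n)
  have hffd : ∀ n z, fderiv ℝ (f n) z = φ z • fderiv ℝ (e n) z + e n z • fderiv ℝ φ z :=
    fun n z => fderiv_fun_mul (hφ.differentiable (by simp) z) ((he n).differentiable (by simp) z)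
  have hfB : ∀ n z, ‖fderiv ℝ (f n) z‖ ≤ M * D + M := fun n z => by
    rw [hffd]
    refine (norm_add_le _ _).trans (add_le_add ?_ ?_)
    · rw [norm_smul]
      refine mul_le_mul (hM z) ((hefd' n z).trans ?_) (norm_nonneg _) hM0
      exact mul_le_of_le_one_left hD0 (hs1 n)
    · rw [norm_smul]
      simpa using mul_le_mul (he1 n z) (hM' z) (norm_nonneg _) zero_le_one
  have hweak : ∀ n, (∫ z in (Ioi 0 ×ˢ univ : Set (ℝ × Plane)),
      acousticPairing K₀ ρ₀ (fderiv ℝ (f n) z) (q z.1 z.2)) + ∫ x : Plane, f n (0, x) • q₀ x = 0 :=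
    fun n => hq.weak (f n) (hf n) (hecpt n).mul_left
  have hlim1 : Tendsto (fun n => ∫ z in (Ioi 0 ×ˢ univ : Set (ℝ × Plane)),
      acousticPairing K₀ ρ₀ (fderiv ℝ (f n) z) (q z.1 z.2)) atTop
      (𝓝 (∫ z in (Ioi 0 ×ˢ univ : Set (ℝ × Plane)),
        acousticPairing K₀ ρ₀ (fderiv ℝ φ z) (q z.1 z.2))) := by
    refine tendsto_integral_of_dominated_convergence _
      (fun n => hq.aestronglyMeasurable_pairing (hf n))
      (hq.integrable_majorant T (C * (M * D + M)))
      (fun n => hbound (f n) _ (by positivity) (fun z hz => by simp [f, hT z hz]) (hfB n))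
      (ae_of_all _ fun z => ?_)
    have h1 : Tendsto (fun n => fderiv ℝ (f n) z) atTop (𝓝 (fderiv ℝ φ z)) := by
      have h2 : Tendsto (fun n => fderiv ℝ (e n) z) atTop (𝓝 0) :=
        squeeze_zero_norm (fun n => hefd' n z) (by simpa using hslim.mul_const D)
      have h3 := (h2.const_smul (φ z)).add ((helim z).smul_const (fderiv ℝ φ z))
      simp only [smul_zero, one_smul, zero_add] at h3
      exact h3.congr fun n => (hffd n z).symm
    exact tendsto_acousticPairing h1 _
  have hlim2 : Tendsto (fun n => ∫ x : Plane, f n (0, x) • q₀ x) atTop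
      (𝓝 (∫ x : Plane, φ (0, x) • q₀ x)) := by
    refine tendsto_integral_of_dominated_convergence (fun x => M * ‖q₀ x‖)
      (fun n => ?_) (hq₀.norm.const_mul M) (fun n => ae_of_all _ fun x => ?_)
      (ae_of_all _ fun x => ?_)
    · exact (((hf n).continuous.comp (by fun_prop)).aestronglyMeasurable).smul
        hq₀.aestronglyMeasurable
    · rw [norm_smul]
      refine mul_le_mul_of_nonneg_right ?_ (norm_nonneg _)
      simp only [f, norm_mul]
      simpa using mul_le_mul (hM (0, x)) (he1 n (0, x)) (abs_nonneg _) hM0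
    · have := ((helim (0, x)).const_mul (φ (0, x))).smul_const (q₀ x)
      simpa [f] using this
  refine tendsto_nhds_unique (hlim1.add hlim2) ?_
  simp only [hweak]
  exact tendsto_const_nhds

/-- A scalar `W` for which `W ℓ` solves the adjoint equations gives a conserved quantity:
the integral of `W ℓ(q)` over the plane has the same value at almost all times. -/
lemma IsAcousticSolution.ae_integral_eq (hq : IsAcousticSolution K₀ ρ₀ q₀ q)
    (hq₀ : Integrable q₀) (ℓ : (Fin 3 → ℝ) →L[ℝ] ℝ) {W : ℝ × Plane → ℝ}
    (hW : ContDiff ℝ (⊤ : ℕ∞) W) {M : ℝ} (hM : ∀ z, |W z| ≤ M) (hM' : ∀ z, ‖fderiv ℝ W z‖ ≤ M)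
    (hadj : ∀ z v, ℓ (acousticPairing K₀ ρ₀ (fderiv ℝ W z) v) = 0) :
    ∀ᵐ t : ℝ, 0 < t → ∫ x : Plane, W (t, x) * ℓ (q t x) = ∫ x : Plane, W (0, x) * ℓ (q₀ x) := by
  have hM0 : 0 ≤ M := (abs_nonneg _).trans (hM 0)
  set m₀ : ℝ := ∫ x : Plane, W (0, x) * ℓ (q₀ x) with hm₀
  let m : ℝ → ℝ := fun t => ∫ x : Plane, W (t, x) * ℓ (q t x)
  have hint : ∀ T : ℝ, IntegrableOn (fun z : ℝ × Plane => W z * ℓ (q z.1 z.2))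
      (Icc 0 T ×ˢ univ) := fun T =>
    (ℓ.integrable_comp (hq.integrableOn T)).bdd_mul
      hW.continuous.aestronglyMeasurable (ae_of_all _ hM)
  have hmint : ∀ T : ℝ, IntegrableOn m (Icc 0 T) := fun T => by
    have h := hint T
    rw [IntegrableOn, Measure.volume_eq_prod, ← Measure.prod_restrict, Measure.restrict_univ] at h
    exact h.integral_prod_left
  suffices h : ∀ᵐ t : ℝ, t ∈ Ioi (0 : ℝ) → m t - m₀ = 0 by
    filter_upwards [h] with t ht h0
    exact sub_eq_zero.mp (ht h0)
  refine isOpen_Ioi.ae_eq_zero_of_integral_contDiff_smul_eq_zero ?_ ?_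
  · intro t ht
    refine ⟨Ioi 0 ∩ Iio (t + 1), inter_mem_nhdsWithin _ (Iio_mem_nhds (by linarith)), ?_⟩
    have hsub : Ioi 0 ∩ Iio (t + 1) ⊆ Icc 0 (t + 1) := fun y hy => ⟨le_of_lt hy.1, le_of_lt hy.2⟩
    exact ((hmint (t + 1)).mono_set hsub).sub
      ((integrableOn_const (by simp)).mono_set hsub)
  intro ψ hψ hψc hψs
  have hψint : Integrable ψ := hψ.continuous.integrable_of_hasCompactSupport hψc
  obtain ⟨T, hT0, hT⟩ : ∃ T : ℝ, 0 ≤ T ∧ ∀ t, T ≤ t → ψ t = 0 := by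
    obtain ⟨T, hT⟩ := hψc.isCompact.isBounded.subset_closedBall 0
    refine ⟨|T| + 1, by positivity, fun t ht => image_eq_zero_of_notMem_tsupport fun h => ?_⟩
    have := hT h
    rw [Metric.mem_closedBall, dist_zero_right, Real.norm_eq_abs] at this
    linarith [le_abs_self t, le_abs_self T]
  have hψneg : ∀ t, t ≤ 0 → ψ t = 0 := fun t ht =>
    image_eq_zero_of_notMem_tsupport fun h => not_lt.mpr ht (hψs h)
  -- the primitive of `ψ` that vanishes at late times serves as the temporal factor
  let χ : ℝ → ℝ := fun t => ∫ τ in T..t, ψ τ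
  have hχd : ∀ t, HasDerivAt χ (ψ t) t := fun t => hψ.continuous.integral_hasStrictDerivAt T t
    |>.hasDerivAt
  have hχ : ContDiff ℝ (⊤ : ℕ∞) χ := by
    rw [contDiff_infty_iff_deriv]
    refine ⟨fun t => (hχd t).differentiableAt, ?_⟩
    rwa [show deriv χ = ψ from funext fun t => (hχd t).deriv]
  have hχT : ∀ t, T ≤ t → χ t = 0 := fun t ht => by
    refine intervalIntegral.integral_zero_ae (ae_of_all _ fun τ hτ => ?_)
    rw [uIoc_of_le ht] at hτ
    exact hT τ hτ.1.le
  obtain ⟨B, hB⟩ := hψc.exists_bound_of_continuous hψ.continuous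
  have hB0 : 0 ≤ B := (norm_nonneg _).trans (hB 0)
  have hχb : ∀ t, |χ t| ≤ ∫ τ, |ψ τ| := fun t => by
    refine (intervalIntegral.norm_integral_le_integral_norm_uIoc (f := ψ) (μ := volume)).trans ?_
    exact setIntegral_le_integral hψint.norm (ae_of_all _ fun _ => norm_nonneg _)
  have hχ0 : χ 0 = -∫ t in Ioi (0 : ℝ), ψ t := by
    simp only [χ]
    rw [intervalIntegral.integral_symm, intervalIntegral.integral_of_le hT0]
    congr 1
    refine (setIntegral_eq_of_subset_of_forall_sdiff_eq_zero measurableSet_Ioi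
      (fun y hy => hy.1) fun t ht => ?_).symm
    by_contra h
    exact ht.2 ⟨ht.1, le_of_not_ge fun h' => h (hT t h')⟩
  set I : ℝ := ∫ τ, |ψ τ|
  have hI0 : 0 ≤ I := integral_nonneg fun _ => abs_nonneg _
  let φ : ℝ × Plane → ℝ := fun z => χ z.1 * W z
  have hχ1 : ∀ z : ℝ × Plane, HasFDerivAt (fun z : ℝ × Plane => χ z.1)
      (ψ z.1 • ContinuousLinearMap.fst ℝ ℝ Plane) z := fun z =>
    (hχd z.1).comp_hasFDerivAt z hasFDerivAt_fst
  have hφfd : ∀ z, fderiv ℝ φ z =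
      χ z.1 • fderiv ℝ W z + W z • (ψ z.1 • ContinuousLinearMap.fst ℝ ℝ Plane) := fun z =>
    ((hχ1 z).mul (hW.differentiable (by simp) z).hasFDerivAt).fderiv
  have hφ : ContDiff ℝ (⊤ : ℕ∞) φ := (hχ.comp contDiff_fst).mul hW
  have hφb : ∀ z, |φ z| ≤ I * M + M * B := fun z => by
    rw [abs_mul]
    have := mul_le_mul (hχb z.1) (hM z) (abs_nonneg _) hI0
    nlinarith [mul_nonneg hM0 hB0]
  have hφb' : ∀ z, ‖fderiv ℝ φ z‖ ≤ I * M + M * B := fun z => by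
    rw [hφfd]
    refine (norm_add_le _ _).trans (add_le_add ?_ ?_)
    · rw [norm_smul]
      exact mul_le_mul (hχb z.1) (hM' z) (norm_nonneg _) hI0
    · rw [norm_smul, norm_smul]
      refine mul_le_mul (hM z) ?_ (by positivity) hM0
      have h1 := ContinuousLinearMap.norm_fst_le ℝ ℝ Plane
      have h2 := hB z.1
      calc ‖ψ z.1‖ * ‖ContinuousLinearMap.fst ℝ ℝ Plane‖ ≤ B * 1 :=
            mul_le_mul h2 h1 (norm_nonneg _) hB0
        _ = B := mul_one B
  obtain ⟨hi, hw⟩ := hq.weak_of_bounded (T := T) hq₀ hφ hφb hφb'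
    (fun z hz => by simp [φ, hχT z.1 hz])
  have hpt : ∀ z v, ℓ (acousticPairing K₀ ρ₀ (fderiv ℝ φ z) v) = ψ z.1 * (W z * ℓ v) := by
    intro z v
    rw [hφfd, acousticPairing_add, acousticPairing_smul, acousticPairing_smul,
      acousticPairing_smul, map_add, map_smul, hadj]
    have : acousticPairing K₀ ρ₀ (ContinuousLinearMap.fst ℝ ℝ Plane) v = v := by
      simp [acousticPairing]
    rw [this]
    simp only [map_smul, smul_eq_mul]; ring
  have hi0 : Integrable (fun x : Plane => φ (0, x) • q₀ x) :=
    hq₀.bdd_smul (I * M + M * B) (hφ.continuous.comp (by fun_prop)).aestronglyMeasurable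
      (ae_of_all _ fun x => hφb (0, x))
  have hw' := congrArg ℓ hw
  rw [map_add, map_zero, ← ℓ.integral_comp_comm hi, ← ℓ.integral_comp_comm hi0] at hw'
  have e1 : ∫ z in (Ioi 0 ×ˢ univ : Set (ℝ × Plane)),
      ℓ (acousticPairing K₀ ρ₀ (fderiv ℝ φ z) (q z.1 z.2)) = ∫ t in Ioi (0 : ℝ), ψ t * m t := by
    have hi' := ℓ.integrable_comp hi
    simp only [hpt] at hi' ⊢
    rw [Measure.volume_eq_prod] at hi' ⊢
    rw [setIntegral_prod _ hi']
    refine setIntegral_congr_fun measurableSet_Ioi fun t _ => ?_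
    simp only [Measure.restrict_univ]
    rw [integral_const_mul]
  have e2 : ∫ x : Plane, ℓ (φ (0, x) • q₀ x) = χ 0 * m₀ := by
    rw [hm₀, ← integral_const_mul]
    refine integral_congr_ae (ae_of_all _ fun x => ?_)
    simp only [map_smul, smul_eq_mul, φ]; ring
  rw [e1, e2, hχ0] at hw'
  have e3 : ∫ t, ψ t • (m t - m₀) = ∫ t in Ioi (0 : ℝ), ψ t • (m t - m₀) :=
    (setIntegral_eq_integral_of_forall_compl_eq_zero fun t ht => by
      rw [hψneg t (not_lt.mp ht), zero_smul]).symm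
  have hψm : IntegrableOn (fun t => ψ t * m t) (Ioi 0) := by
    have h1 : IntegrableOn (fun t => ψ t * m t) (Icc 0 T) :=
      (hmint T).bdd_mul hψ.continuous.aestronglyMeasurable (ae_of_all _ hB)
    refine (integrableOn_iff_integrable_of_support_subset (s := Icc 0 T) ?_).mp h1 |>.integrableOn
    intro t ht
    by_contra h
    refine ht ?_
    rcases not_and_or.mp h with h | h
    · simp [hψneg t (not_le.mp h).le]
    · simp [hT t (not_le.mp h).le]
  rw [e3]
  simp only [smul_eq_mul, mul_sub]
  rw [integral_sub hψm (hψint.integrableOn.mul_const m₀), integral_mul_const]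
  linarith
end

/-! ### Circle averages of the resolvent -/

/-- The denominator `c - i r cos φ`, which for `c = ε + i a` is `ε + i (a - r cos φ)`. -/
noncomputable def circleDenom (c : ℂ) (r φ : ℝ) : ℂ := c - Complex.I * r * Real.cos φ

lemma circleDenom_re (c : ℂ) (r φ : ℝ) : (circleDenom c r φ).re = c.re := by
  simp [circleDenom, Complex.cos_ofReal_re]

lemma circleDenom_im (c : ℂ) (r φ : ℝ) : (circleDenom c r φ).im = c.im - r * Real.cos φ := by
  simp [circleDenom, Complex.cos_ofReal_re]

lemma circleDenom_ne_zero {c : ℂ} (hc : 0 < c.re) (r φ : ℝ) : circleDenom c r φ ≠ 0 := fun h => by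
  have := circleDenom_re c r φ
  rw [h] at this
  simp only [Complex.zero_re] at this
  linarith

lemma continuous_circleDenom (c : ℂ) (r : ℝ) : Continuous (circleDenom c r) := by
  unfold circleDenom; fun_prop

lemma le_norm_circleDenom (c : ℂ) (r φ : ℝ) : c.re ≤ ‖circleDenom c r φ‖ := by
  rw [← circleDenom_re c r φ]
  exact Complex.re_le_norm _

/-- The integral of `1 / (c - i r cos φ)` over a period. -/
noncomputable def circleResolvent (c : ℂ) (r : ℝ) : ℂ :=
  ∫ φ in (0 : ℝ)..2 * Real.pi, (circleDenom c r φ)⁻¹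

lemma continuous_inv_circleDenom {c : ℂ} (hc : 0 < c.re) (r : ℝ) :
    Continuous fun φ => (circleDenom c r φ)⁻¹ :=
  (continuous_circleDenom c r).inv₀ (circleDenom_ne_zero hc r)

lemma continuous_inv_circleDenom_sq {c : ℂ} (hc : 0 < c.re) (r : ℝ) :
    Continuous fun φ => (circleDenom c r φ ^ 2)⁻¹ :=
  ((continuous_circleDenom c r).pow 2).inv₀ fun φ => pow_ne_zero 2 (circleDenom_ne_zero hc r φ)

/-- The integrand is the derivative of `sin φ / (c - i r cos φ)`. -/
lemma integral_circleDenom_exact {c : ℂ} (hc : 0 < c.re) (r : ℝ) :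
    ∫ φ in (0 : ℝ)..2 * Real.pi,
      (c * (Real.cos φ : ℂ) - Complex.I * r) * (circleDenom c r φ ^ 2)⁻¹ = 0 := by
  have hd : ∀ φ : ℝ, HasDerivAt (fun φ : ℝ => (Real.sin φ : ℂ) / circleDenom c r φ)
      ((c * (Real.cos φ : ℂ) - Complex.I * r) * (circleDenom c r φ ^ 2)⁻¹) φ := fun φ => by
    have hs : HasDerivAt (fun φ : ℝ => (Real.sin φ : ℂ)) (Real.cos φ : ℂ) φ :=
      (Real.hasDerivAt_sin φ).ofReal_comp
    have hcos : HasDerivAt (fun φ : ℝ => (Real.cos φ : ℂ)) ((-Real.sin φ : ℝ) : ℂ) φ :=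
      (Real.hasDerivAt_cos φ).ofReal_comp
    have hX : HasDerivAt (circleDenom c r) (-(Complex.I * r * ((-Real.sin φ : ℝ) : ℂ))) φ :=
      (hcos.const_mul (Complex.I * r)).const_sub c
    refine (hs.fun_div hX (circleDenom_ne_zero hc r φ)).congr_deriv ?_
    rw [div_eq_mul_inv]
    congr 1
    have h1 : (Real.sin φ : ℂ) ^ 2 = 1 - (Real.cos φ : ℂ) ^ 2 := by
      rw [eq_sub_iff_add_eq]; exact_mod_cast Real.sin_sq_add_cos_sq φ
    simp only [circleDenom, Complex.ofReal_neg]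
    linear_combination (-Complex.I * r) * h1
  rw [intervalIntegral.integral_eq_sub_of_hasDerivAt (fun φ _ => hd φ)]
  · simp
  · refine Continuous.intervalIntegrable ?_ _ _
    exact Continuous.mul (by fun_prop) (continuous_inv_circleDenom_sq hc r)

lemma integral_inv_circleDenom_sq {c : ℂ} (hc : 0 < c.re) (r : ℝ) :
    (c ^ 2 + r ^ 2) * ∫ φ in (0 : ℝ)..2 * Real.pi, (circleDenom c r φ ^ 2)⁻¹ =
      c * circleResolvent c r := by
  have h := integral_circleDenom_exact hc r
  rw [circleResolvent, ← intervalIntegral.integral_const_mul,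
    ← intervalIntegral.integral_const_mul, ← sub_eq_zero, ← intervalIntegral.integral_sub]
  · calc _ = ∫ φ in (0 : ℝ)..2 * Real.pi, (Complex.I * r) *
          ((c * (Real.cos φ : ℂ) - Complex.I * r) * (circleDenom c r φ ^ 2)⁻¹) := by
          refine intervalIntegral.integral_congr fun φ _ => ?_
          have hX := circleDenom_ne_zero hc r φ
          have hrC : Complex.I * r * (Real.cos φ : ℂ) = c - circleDenom c r φ := by
            simp [circleDenom]
          have e : (circleDenom c r φ)⁻¹ = circleDenom c r φ * (circleDenom c r φ ^ 2)⁻¹ := by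
            field_simp
          rw [e]
          linear_combination (-c * (circleDenom c r φ ^ 2)⁻¹) * hrC +
            (r ^ 2 * (circleDenom c r φ ^ 2)⁻¹) * Complex.I_sq
      _ = 0 := by rw [intervalIntegral.integral_const_mul, h, mul_zero]
  · exact ((continuous_inv_circleDenom_sq hc r).const_mul _).intervalIntegrable _ _
  · exact ((continuous_inv_circleDenom hc r).const_mul _).intervalIntegrable _ _

lemma hasDerivAt_circleResolvent {c : ℂ} (hc : 0 < c.re) (r : ℝ) :
    HasDerivAt (circleResolvent c)
      (∫ φ in (0 : ℝ)..2 * Real.pi,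
        Complex.I * (Real.cos φ : ℂ) * (circleDenom c r φ ^ 2)⁻¹) r := by
  refine (intervalIntegral.hasDerivAt_integral_of_dominated_loc_of_deriv_le
    (F := fun r φ => (circleDenom c r φ)⁻¹)
    (F' := fun r φ => Complex.I * (Real.cos φ : ℂ) * (circleDenom c r φ ^ 2)⁻¹)
    (bound := fun _ => (c.re ^ 2)⁻¹) (s := univ) univ_mem
    (Eventually.of_forall fun r => (continuous_inv_circleDenom hc r).aestronglyMeasurable)
    ((continuous_inv_circleDenom hc r).intervalIntegrable _ _) ?_ ?_ (by simp) ?_).2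
  · refine Continuous.aestronglyMeasurable ?_
    exact Continuous.mul (by fun_prop) (continuous_inv_circleDenom_sq hc r)
  · refine ae_of_all _ fun φ _ r _ => ?_
    rw [norm_mul, norm_mul, norm_inv, norm_pow, Complex.norm_I, one_mul, Complex.norm_real]
    calc ‖Real.cos φ‖ * (‖circleDenom c r φ‖ ^ 2)⁻¹ ≤ 1 * (c.re ^ 2)⁻¹ := by
          gcongr
          · exact Real.abs_cos_le_one φ
          · exact le_norm_circleDenom c r φ
      _ = _ := one_mul _
  · refine ae_of_all _ fun φ _ r _ => ?_
    have h1 : HasDerivAt (fun r : ℝ => (r : ℂ)) 1 r := Complex.ofRealCLM.hasDerivAt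
    have hX : HasDerivAt (fun r : ℝ => circleDenom c r φ)
        (-(Complex.I * 1 * (Real.cos φ : ℂ))) r :=
      ((h1.const_mul Complex.I).mul_const (Real.cos φ : ℂ)).const_sub c
    refine (hX.fun_inv (circleDenom_ne_zero hc r φ)).congr_deriv ?_
    rw [div_eq_mul_inv]; ring

/-- The closed form of the circle average, up to the sign of the square root: the
derivative in `r` of the left-hand side vanishes. -/
lemma circleResolvent_sq {c : ℂ} (hc : 0 < c.re) (r : ℝ) :
    circleResolvent c r ^ 2 * (c ^ 2 + r ^ 2) = (2 * Real.pi) ^ 2 := by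
  have hode : ∀ r : ℝ, (c ^ 2 + r ^ 2) * (∫ φ in (0 : ℝ)..2 * Real.pi,
      Complex.I * (Real.cos φ : ℂ) * (circleDenom c r φ ^ 2)⁻¹) + r * circleResolvent c r = 0 := by
    intro r
    have h := integral_circleDenom_exact hc r
    rw [circleResolvent, ← intervalIntegral.integral_const_mul,
      ← intervalIntegral.integral_const_mul, ← intervalIntegral.integral_add]
    · calc _ = ∫ φ in (0 : ℝ)..2 * Real.pi, (Complex.I * c) *
            ((c * (Real.cos φ : ℂ) - Complex.I * r) * (circleDenom c r φ ^ 2)⁻¹) := by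
            refine intervalIntegral.integral_congr fun φ _ => ?_
            have hX := circleDenom_ne_zero hc r φ
            have hX' : circleDenom c r φ = c - Complex.I * r * (Real.cos φ : ℂ) := rfl
            have e : (circleDenom c r φ)⁻¹ = circleDenom c r φ * (circleDenom c r φ ^ 2)⁻¹ := by
              field_simp
            rw [e]
            linear_combination (r * (circleDenom c r φ ^ 2)⁻¹) * hX' +
              (c * r * (circleDenom c r φ ^ 2)⁻¹) * Complex.I_sq
        _ = 0 := by rw [intervalIntegral.integral_const_mul, h, mul_zero]
    · refine Continuous.intervalIntegrable ?_ _ _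
      exact Continuous.const_mul (Continuous.mul (by fun_prop)
        (continuous_inv_circleDenom_sq hc r)) _
    · exact ((continuous_inv_circleDenom hc r).const_mul _).intervalIntegrable _ _
  have hd : ∀ r : ℝ, HasDerivAt (fun r : ℝ => circleResolvent c r ^ 2 * (c ^ 2 + (r : ℂ) ^ 2))
      0 r := fun r => by
    have h1 : HasDerivAt (fun r : ℝ => (r : ℂ)) 1 r := Complex.ofRealCLM.hasDerivAt
    have h2 := ((hasDerivAt_circleResolvent hc r).fun_pow 2).fun_mul
      ((h1.fun_pow 2).const_add (c ^ 2))
    refine h2.congr_deriv ?_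
    simp only [Nat.cast_ofNat, Nat.add_one_sub_one, pow_one, mul_one]
    linear_combination (2 * circleResolvent c r) * hode r
  have hconst := is_const_of_deriv_eq_zero (fun r => (hd r).differentiableAt)
    (fun r => (hd r).deriv) r 0
  rw [hconst]
  have hc0 : c ≠ 0 := fun h => by simp [h] at hc
  have : circleResolvent c 0 = 2 * Real.pi * c⁻¹ := by
    simp [circleResolvent, circleDenom]
  rw [this]
  simp only [Complex.ofReal_zero]
  field_simp
  simp

lemma circleResolvent_re_pos {c : ℂ} (hc : 0 < c.re) (r : ℝ) : 0 < (circleResolvent c r).re := by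
  have h : (circleResolvent c r).re =
      ∫ φ in (0 : ℝ)..2 * Real.pi, ((circleDenom c r φ)⁻¹).re :=
    (Complex.reCLM.intervalIntegral_comp_comm
      ((continuous_inv_circleDenom hc r).intervalIntegrable _ _)).symm
  rw [h]
  refine intervalIntegral.intervalIntegral_pos_of_pos ?_ (fun φ => ?_) (by positivity)
  · exact (Complex.continuous_re.comp (continuous_inv_circleDenom hc r)).intervalIntegrable _ _
  · rw [Complex.inv_re, circleDenom_re]
    exact div_pos hc (Complex.normSq_pos.mpr (circleDenom_ne_zero hc r φ))

lemma circleResolvent_ne_zero {c : ℂ} (hc : 0 < c.re) (r : ℝ) :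
    circleResolvent c r ≠ 0 := fun h => by
  have := circleResolvent_re_pos hc r
  simp [h] at this

/-- The first cosine moment is dominated by the mean. With `S = 2π / circleResolvent c r`, so that
`S² = c² + r²`, it amounts to `|S - c| ≤ |r|`, which holds since `S` and `c` lie in the same
quadrant of the right half-plane. -/
lemma norm_integral_cos_mul_inv_circleDenom_le {c : ℂ} (hc : 0 < c.re) (r : ℝ) :
    ‖∫ φ in (0 : ℝ)..2 * Real.pi, (Real.cos φ : ℂ) * (circleDenom c r φ)⁻¹‖ ≤
      ‖circleResolvent c r‖ := by
  rcases eq_or_ne r 0 with rfl | hr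
  · have : ∫ φ in (0 : ℝ)..2 * Real.pi, (Real.cos φ : ℂ) * (circleDenom c 0 φ)⁻¹ = 0 := by
      simp only [circleDenom, Complex.ofReal_zero, mul_zero, zero_mul, sub_zero]
      rw [intervalIntegral.integral_mul_const, intervalIntegral.integral_ofReal]
      simp
    rw [this]; simp
  set A := circleResolvent c r with hA
  set J := ∫ φ in (0 : ℝ)..2 * Real.pi, (Real.cos φ : ℂ) * (circleDenom c r φ)⁻¹ with hJ
  have hA0 : A ≠ 0 := circleResolvent_ne_zero hc r
  have hrel : c * A - Complex.I * r * J = 2 * Real.pi := by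
    rw [hA, hJ, circleResolvent, ← intervalIntegral.integral_const_mul,
      ← intervalIntegral.integral_const_mul, ← intervalIntegral.integral_sub]
    · calc _ = ∫ φ in (0 : ℝ)..2 * Real.pi, (1 : ℂ) := by
            refine intervalIntegral.integral_congr fun φ _ => ?_
            have hX := circleDenom_ne_zero hc r φ
            have hX' : circleDenom c r φ = c - Complex.I * r * (Real.cos φ : ℂ) := rfl
            rw [← mul_inv_cancel₀ hX]
            linear_combination (-(circleDenom c r φ)⁻¹) * hX'
        _ = _ := by simp
    · exact ((continuous_inv_circleDenom hc r).const_mul _).intervalIntegrable _ _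
    · refine Continuous.intervalIntegrable ?_ _ _
      exact Continuous.const_mul (Continuous.mul (by fun_prop) (continuous_inv_circleDenom hc r)) _
  set S : ℂ := 2 * Real.pi / A with hS
  have hSA : S * A = 2 * Real.pi := div_mul_cancel₀ _ hA0
  have hS2 : S ^ 2 = c ^ 2 + r ^ 2 := by
    have h := circleResolvent_sq hc r
    rw [← hA, ← hSA] at h
    have : A ^ 2 * (S ^ 2 - (c ^ 2 + r ^ 2)) = 0 := by linear_combination -h
    exact sub_eq_zero.mp ((mul_eq_zero.mp this).resolve_left (pow_ne_zero 2 hA0))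
  have hSre : 0 < S.re := by
    have h1 : S = ((2 * Real.pi : ℝ) : ℂ) * A⁻¹ := by rw [hS, div_eq_mul_inv]; push_cast; ring
    rw [h1, Complex.re_ofReal_mul, Complex.inv_re]
    have := circleResolvent_re_pos hc r
    have h2 := Complex.normSq_pos.mpr hA0
    positivity
  have him : S.re * S.im = c.re * c.im := by
    have := congrArg Complex.im hS2
    simp [pow_two] at this
    linarith
  have hdot : 0 ≤ S.re * c.re + S.im * c.im := by
    have h1 : S.re * (S.im * c.im) = c.re * c.im ^ 2 := by linear_combination c.im * him
    have h2 : 0 ≤ S.im * c.im := by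
      by_contra h
      have h3 := mul_neg_of_pos_of_neg hSre (not_le.mp h)
      have h4 : 0 ≤ c.re * c.im ^ 2 := by positivity
      linarith
    have := mul_pos hSre hc
    linarith
  have hprod : (S - c) * (S + c) = (r : ℂ) ^ 2 := by linear_combination hS2
  have hle : ‖S - c‖ ^ 2 ≤ ‖S + c‖ ^ 2 := by
    rw [Complex.sq_norm, Complex.sq_norm, Complex.normSq_apply, Complex.normSq_apply]
    simp only [Complex.sub_re, Complex.sub_im, Complex.add_re, Complex.add_im]
    nlinarith
  have hle' : ‖S - c‖ ≤ ‖S + c‖ := le_of_sq_le_sq hle (norm_nonneg _)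
  have hr2 : ‖S - c‖ * ‖S + c‖ = |r| ^ 2 := by
    rw [← norm_mul, hprod, norm_pow, Complex.norm_real, Real.norm_eq_abs]
  have hSc : ‖S - c‖ ≤ |r| := by
    refine le_of_sq_le_sq ?_ (abs_nonneg r)
    rw [← hr2, sq]
    exact mul_le_mul_of_nonneg_left hle' (norm_nonneg _)
  have hJA : |r| * ‖J‖ = ‖A‖ * ‖S - c‖ := by
    have h1 : Complex.I * r * J = A * (c - S) := by linear_combination -hrel + hSA
    have h2 := congrArg norm h1
    rw [norm_mul, norm_mul, norm_mul, Complex.norm_I, one_mul, Complex.norm_real,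
      Real.norm_eq_abs, norm_sub_rev c S] at h2
    exact h2
  have hr0 : 0 < |r| := abs_pos.mpr hr
  nlinarith [norm_nonneg A, norm_nonneg J]

lemma norm_circleResolvent_le {c : ℂ} (hc : 0 < c.re) (r : ℝ) (h : 0 < |c.im + r| * |c.im - r|) :
    ‖circleResolvent c r‖ ≤ 2 * Real.pi / √(|c.im + r| * |c.im - r|) := by
  have h1 : |c.im + r| * |c.im - r| ≤ ‖c ^ 2 + (r : ℂ) ^ 2‖ := by
    have : c ^ 2 + (r : ℂ) ^ 2 = (c + Complex.I * r) * (c - Complex.I * r) := by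
      linear_combination ((r : ℂ) ^ 2) * Complex.I_sq
    rw [this, norm_mul]
    refine mul_le_mul ?_ ?_ (abs_nonneg _) (norm_nonneg _)
    · simpa using Complex.abs_im_le_norm (c + Complex.I * r)
    · simpa using Complex.abs_im_le_norm (c - Complex.I * r)
  have h2 : ‖circleResolvent c r‖ ^ 2 * ‖c ^ 2 + (r : ℂ) ^ 2‖ = (2 * Real.pi) ^ 2 := by
    rw [← norm_pow, ← norm_mul, circleResolvent_sq hc r, norm_pow, norm_mul, Complex.norm_real,
      Real.norm_of_nonneg Real.pi_pos.le]
    simp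
  rw [le_div_iff₀ (Real.sqrt_pos.mpr h)]
  refine le_of_sq_le_sq ?_ (by positivity)
  rw [mul_pow, Real.sq_sqrt h.le, ← h2]
  exact mul_le_mul_of_nonneg_left h1 (by positivity)

/-! ### The plane-wave kernel of the Poisson kernel -/

/-- The real part of `1 / (ε + i s) ^ 2`. Up to a factor, its average over all directions is the
Poisson kernel of the upper half-space over the plane. -/
noncomputable def planeKernel (ε s : ℝ) : ℝ := (ε ^ 2 - s ^ 2) / (ε ^ 2 + s ^ 2) ^ 2

/-- The primitive `s / (ε² + s²)` of `planeKernel ε`, the negative imaginary part of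
`1 / (ε + i s)`. -/
noncomputable def conjKernel (ε s : ℝ) : ℝ := s / (ε ^ 2 + s ^ 2)

/-- The vector `(1, ω)` for the direction `ω` at angle `θ`. -/
noncomputable def waveVec (θ : ℝ) : Fin 3 → ℝ := ![1, Real.cos θ, Real.sin θ]

lemma continuous_waveVec (i : Fin 3) : Continuous fun θ => waveVec θ i := by
  fin_cases i
  · exact continuous_const
  · exact Real.continuous_cos
  · exact Real.continuous_sin

lemma abs_waveVec_le (θ : ℝ) (i : Fin 3) : |waveVec θ i| ≤ 1 := by
  fin_cases i
  · simp [waveVec]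
  · exact Real.abs_cos_le_one θ
  · exact Real.abs_sin_le_one θ

lemma planeKernel_neg (ε s : ℝ) : planeKernel ε (-s) = planeKernel ε s := by
  simp [planeKernel]

lemma contDiff_planeKernel {ε : ℝ} (hε : 0 < ε) : ContDiff ℝ (⊤ : ℕ∞) (planeKernel ε) := by
  unfold planeKernel
  refine ContDiff.div (by fun_prop) (by fun_prop) fun s => ?_
  positivity

lemma continuous_conjKernel {ε : ℝ} (hε : 0 < ε) : Continuous (conjKernel ε) := by
  unfold conjKernel
  refine Continuous.div (by fun_prop) (by fun_prop) fun s => ?_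
  positivity

lemma hasDerivAt_conjKernel {ε : ℝ} (hε : 0 < ε) (s : ℝ) :
    HasDerivAt (conjKernel ε) (planeKernel ε s) s := by
  have h := (hasDerivAt_id s).fun_div (((hasDerivAt_id s).fun_pow 2).const_add (ε ^ 2))
    (by positivity)
  refine h.congr_deriv ?_
  simp only [planeKernel, id_eq]
  congr 1
  push_cast
  ring

lemma abs_conjKernel_le {ε : ℝ} (hε : 0 < ε) (s : ℝ) : |conjKernel ε s| ≤ ε⁻¹ := by
  rw [conjKernel, abs_div, abs_of_pos (show 0 < ε ^ 2 + s ^ 2 by positivity), div_le_iff₀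
    (by positivity), ← sub_nonneg, ← sq_abs s]
  have : ε⁻¹ * (ε ^ 2 + |s| ^ 2) - |s| = ε⁻¹ * ((ε - |s| / 2) ^ 2 + 3 / 4 * |s| ^ 2) := by
    field_simp; ring
  rw [this]; positivity

lemma abs_planeKernel_le {ε : ℝ} (hε : 0 < ε) (s : ℝ) : |planeKernel ε s| ≤ (ε ^ 2)⁻¹ := by
  rw [planeKernel, abs_div, abs_of_pos (show 0 < (ε ^ 2 + s ^ 2) ^ 2 by positivity), div_le_iff₀
    (by positivity)]
  calc |ε ^ 2 - s ^ 2| ≤ ε ^ 2 + s ^ 2 := by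
        rw [abs_le]; constructor <;> nlinarith [sq_nonneg ε, sq_nonneg s]
    _ ≤ (ε ^ 2)⁻¹ * (ε ^ 2 + s ^ 2) ^ 2 := by
        rw [← sub_nonneg]
        have : (ε ^ 2)⁻¹ * (ε ^ 2 + s ^ 2) ^ 2 - (ε ^ 2 + s ^ 2) =
          (ε ^ 2)⁻¹ * (s ^ 2 * (ε ^ 2 + s ^ 2)) := by field_simp; ring
        rw [this]; positivity

lemma exists_abs_deriv_planeKernel_le {ε : ℝ} (hε : 0 < ε) :
    ∃ B : ℝ, ∀ s, |deriv (planeKernel ε) s| ≤ B := by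
  have hd : ∀ s, HasDerivAt (planeKernel ε)
      (s * (2 * s ^ 2 - 6 * ε ^ 2) / (ε ^ 2 + s ^ 2) ^ 3) s := fun s => by
    have hpos : 0 < ε ^ 2 + s ^ 2 := by positivity
    have h := (((hasDerivAt_id s).fun_pow 2).const_sub (ε ^ 2)).fun_div
      ((((hasDerivAt_id s).fun_pow 2).const_add (ε ^ 2)).fun_pow 2) (by positivity)
    refine h.congr_deriv ?_
    simp only [id_eq]
    field_simp
    push_cast
    ring
  refine ⟨6 * (ε ^ 2)⁻¹ * ε⁻¹, fun s => ?_⟩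
  rw [(hd s).deriv]
  have hpos : 0 < ε ^ 2 + s ^ 2 := by positivity
  have e : s * (2 * s ^ 2 - 6 * ε ^ 2) / (ε ^ 2 + s ^ 2) ^ 3 =
      ((2 * s ^ 2 - 6 * ε ^ 2) / (ε ^ 2 + s ^ 2) ^ 2) * conjKernel ε s := by
    rw [conjKernel]; field_simp
  rw [e, abs_mul]
  refine mul_le_mul ?_ (abs_conjKernel_le hε s) (abs_nonneg _) (by positivity)
  rw [abs_div, abs_of_pos (show 0 < (ε ^ 2 + s ^ 2) ^ 2 by positivity), div_le_iff₀
    (by positivity)]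
  calc |2 * s ^ 2 - 6 * ε ^ 2| ≤ 6 * (ε ^ 2 + s ^ 2) := by
        rw [abs_le]; constructor <;> nlinarith [sq_nonneg ε, sq_nonneg s]
    _ ≤ 6 * (ε ^ 2)⁻¹ * (ε ^ 2 + s ^ 2) ^ 2 := by
        rw [← sub_nonneg]
        have : 6 * (ε ^ 2)⁻¹ * (ε ^ 2 + s ^ 2) ^ 2 - 6 * (ε ^ 2 + s ^ 2) =
          6 * (ε ^ 2)⁻¹ * (s ^ 2 * (ε ^ 2 + s ^ 2)) := by field_simp; ring
        rw [this]; positivity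

lemma integral_period_shift {f : ℝ → ℝ} (hf : Function.Periodic f (2 * Real.pi)) (α : ℝ) :
    ∫ θ in (0 : ℝ)..2 * Real.pi, f θ = ∫ φ in (0 : ℝ)..2 * Real.pi, f (φ + α) := by
  rw [intervalIntegral.integral_comp_add_right, zero_add, add_comm (2 * Real.pi) α,
    hf.intervalIntegral_add_eq α 0, zero_add]

lemma integral_sin_mul_comp_cos (h : ℝ → ℝ) :
    ∫ φ in (0 : ℝ)..2 * Real.pi, Real.sin φ * h (Real.cos φ) = 0 := by
  have e := intervalIntegral.integral_comp_sub_left (a := 0) (b := 2 * Real.pi)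
    (fun φ => Real.sin φ * h (Real.cos φ)) (2 * Real.pi)
  simp only [Real.sin_two_pi_sub, Real.cos_two_pi_sub, neg_mul, sub_self, sub_zero] at e
  rw [intervalIntegral.integral_neg] at e
  linarith

lemma conjKernel_eq_im (ε a r φ : ℝ) :
    conjKernel ε (a - r * Real.cos φ) = -((circleDenom (ε + a * Complex.I) r φ)⁻¹).im := by
  rw [Complex.inv_im, Complex.normSq_apply, circleDenom_re, circleDenom_im, conjKernel]
  simp only [Complex.add_re, Complex.add_im, Complex.ofReal_re, Complex.ofReal_im,
    Complex.mul_re, Complex.mul_im, Complex.I_re, Complex.I_im]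
  ring

/-- Averaging over all directions softens the profile `conjKernel ε`, which approaches a simple pole
as `ε → 0`, to an inverse square root singularity on `a = ± r`, uniformly in `ε`. -/
lemma abs_integral_waveVec_mul_conjKernel_le {ε : ℝ} (hε : 0 < ε) {a r : ℝ} (α : ℝ) (i : Fin 3)
    (h : 0 < |a + r| * |a - r|) :
    |∫ θ in (0 : ℝ)..2 * Real.pi, waveVec θ i * conjKernel ε (a - r * Real.cos (θ - α))| ≤
      2 * Real.pi / √(|a + r| * |a - r|) := by
  set c : ℂ := ε + a * Complex.I with hc
  have hcre : c.re = ε := by simp [hc]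
  have hcim : c.im = a := by simp [hc]
  have hc0 : 0 < c.re := hcre ▸ hε
  have hA : ‖circleResolvent c r‖ ≤ 2 * Real.pi / √(|a + r| * |a - r|) := by
    have := norm_circleResolvent_le hc0 r (by rwa [hcim])
    rwa [hcim] at this
  have hmean : |∫ φ in (0 : ℝ)..2 * Real.pi, conjKernel ε (a - r * Real.cos φ)| ≤
      2 * Real.pi / √(|a + r| * |a - r|) := by
    refine le_trans ?_ hA
    simp only [conjKernel_eq_im]
    rw [intervalIntegral.integral_neg, abs_neg]
    have := Complex.imCLM.intervalIntegral_comp_comm (μ := volume)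
      ((continuous_inv_circleDenom hc0 r).intervalIntegrable 0 (2 * Real.pi))
    simp only [Complex.imCLM_apply] at this
    rw [this]
    exact Complex.abs_im_le_norm _
  have hcos : |∫ φ in (0 : ℝ)..2 * Real.pi, Real.cos φ * conjKernel ε (a - r * Real.cos φ)| ≤
      2 * Real.pi / √(|a + r| * |a - r|) := by
    refine le_trans ?_ hA
    refine le_trans ?_ (norm_integral_cos_mul_inv_circleDenom_le hc0 r)
    have := Complex.imCLM.intervalIntegral_comp_comm (μ := volume)
      ((Continuous.mul (by fun_prop : Continuous fun φ : ℝ => (Real.cos φ : ℂ))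
        (continuous_inv_circleDenom hc0 r)).intervalIntegrable 0 (2 * Real.pi))
    simp only [Complex.imCLM_apply, Pi.mul_apply, Complex.im_ofReal_mul] at this
    simp only [conjKernel_eq_im, mul_neg]
    rw [intervalIntegral.integral_neg, abs_neg, this]
    exact Complex.abs_im_le_norm _
  have hsin := integral_sin_mul_comp_cos fun x => conjKernel ε (a - r * x)
  have hper : ∀ i, Function.Periodic
      (fun θ => waveVec θ i * conjKernel ε (a - r * Real.cos (θ - α))) (2 * Real.pi) := by
    intro i θ
    have h1 : Real.cos (θ + 2 * Real.pi - α) = Real.cos (θ - α) := by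
      rw [show θ + 2 * Real.pi - α = θ - α + 2 * Real.pi by ring, Real.cos_add_two_pi]
    simp only [waveVec, h1, Real.cos_add_two_pi, Real.sin_add_two_pi]
  have hk : Continuous fun φ => conjKernel ε (a - r * Real.cos φ) :=
    (continuous_conjKernel hε).comp (by fun_prop)
  have i1 : IntervalIntegrable (fun φ => Real.cos φ * conjKernel ε (a - r * Real.cos φ)) volume
      0 (2 * Real.pi) := (Real.continuous_cos.mul hk).intervalIntegrable _ _
  have i2 : IntervalIntegrable (fun φ => Real.sin φ * conjKernel ε (a - r * Real.cos φ)) volume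
      0 (2 * Real.pi) := (Real.continuous_sin.mul hk).intervalIntegrable _ _
  rw [integral_period_shift (hper i) α]
  simp only [add_sub_cancel_right]
  fin_cases i
  · simpa [waveVec] using hmean
  · have : ∫ φ in (0 : ℝ)..2 * Real.pi, waveVec (φ + α) 1 *
        conjKernel ε (a - r * Real.cos φ) = Real.cos α * ∫ φ in (0 : ℝ)..2 * Real.pi,
          Real.cos φ * conjKernel ε (a - r * Real.cos φ) := by
      calc _ = ∫ φ in (0 : ℝ)..2 * Real.pi,
            (Real.cos α * (Real.cos φ * conjKernel ε (a - r * Real.cos φ)) -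
              Real.sin α * (Real.sin φ * conjKernel ε (a - r * Real.cos φ))) := by
            refine intervalIntegral.integral_congr fun φ _ => ?_
            simp only [waveVec, Real.cos_add, Matrix.cons_val_one, Matrix.cons_val_zero]
            ring
        _ = _ := by
            rw [intervalIntegral.integral_sub (i1.const_mul _) (i2.const_mul _),
              intervalIntegral.integral_const_mul, intervalIntegral.integral_const_mul, hsin]
            ring
    refine le_trans (le_of_eq ?_) (le_trans (mul_le_of_le_one_left (abs_nonneg _)
      (Real.abs_cos_le_one α)) hcos)
    rw [← abs_mul, ← this]; rfl
  · have : ∫ φ in (0 : ℝ)..2 * Real.pi, waveVec (φ + α) 2 *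
        conjKernel ε (a - r * Real.cos φ) = Real.sin α * ∫ φ in (0 : ℝ)..2 * Real.pi,
          Real.cos φ * conjKernel ε (a - r * Real.cos φ) := by
      calc _ = ∫ φ in (0 : ℝ)..2 * Real.pi,
            (Real.cos α * (Real.sin φ * conjKernel ε (a - r * Real.cos φ)) +
              Real.sin α * (Real.cos φ * conjKernel ε (a - r * Real.cos φ))) := by
            refine intervalIntegral.integral_congr fun φ _ => ?_
            simp only [waveVec, Real.sin_add, Matrix.cons_val]
            ring
        _ = _ := by
            rw [intervalIntegral.integral_add (i2.const_mul _) (i1.const_mul _),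
              intervalIntegral.integral_const_mul, intervalIntegral.integral_const_mul, hsin]
            ring
    refine le_trans (le_of_eq ?_) (le_trans (mul_le_of_le_one_left (abs_nonneg _)
      (Real.abs_sin_le_one α)) hcos)
    rw [← abs_mul, ← this]; rfl

lemma planeKernel_eq_re (ε r φ : ℝ) :
    planeKernel ε (r * Real.cos φ) = ((circleDenom (ε : ℂ) r φ ^ 2)⁻¹).re := by
  rw [← inv_pow, pow_two, Complex.mul_re, Complex.inv_re, Complex.inv_im, Complex.normSq_apply,
    circleDenom_re, circleDenom_im, planeKernel]
  simp only [Complex.ofReal_re, Complex.ofReal_im, zero_sub, neg_neg, neg_mul_neg]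
  rw [div_mul_div_comm, div_mul_div_comm, ← sub_div]
  congr 1 <;> ring

/-- The plane-wave decomposition of the Poisson kernel. -/
lemma integral_planeKernel_cos {ε : ℝ} (hε : 0 < ε) (r α : ℝ) :
    ∫ θ in (0 : ℝ)..2 * Real.pi, planeKernel ε (r * Real.cos (θ - α)) =
      2 * Real.pi * (ε / ((ε ^ 2 + r ^ 2) * √(ε ^ 2 + r ^ 2))) := by
  have hper : Function.Periodic (fun θ => planeKernel ε (r * Real.cos (θ - α)))
      (2 * Real.pi) := by
    intro θ
    have h1 : Real.cos (θ + 2 * Real.pi - α) = Real.cos (θ - α) := by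
      rw [show θ + 2 * Real.pi - α = θ - α + 2 * Real.pi by ring, Real.cos_add_two_pi]
    simp only [h1]
  rw [integral_period_shift hper α]
  simp only [add_sub_cancel_right, planeKernel_eq_re]
  have hc0 : 0 < (ε : ℂ).re := by simpa using hε
  set A := circleResolvent (ε : ℂ) r with hA
  have hpos : 0 < ε ^ 2 + r ^ 2 := by positivity
  have hsq := circleResolvent_sq hc0 r
  have hApos := circleResolvent_re_pos hc0 r
  rw [← hA] at hsq hApos
  have hAim : A.im = 0 := by
    have h1 := congrArg Complex.im hsq
    have e1 : ((ε : ℂ) ^ 2 + (r : ℂ) ^ 2) = ((ε ^ 2 + r ^ 2 : ℝ) : ℂ) := by push_cast; ring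
    have e2 : ((2 * Real.pi) ^ 2 : ℂ) = (((2 * Real.pi) ^ 2 : ℝ) : ℂ) := by push_cast; ring
    rw [e1, e2, Complex.im_mul_ofReal, Complex.ofReal_im, pow_two, Complex.mul_im] at h1
    have h2 := (mul_eq_zero.mp h1).resolve_right hpos.ne'
    have h3 : A.re * A.im = 0 := by linarith
    exact (mul_eq_zero.mp h3).resolve_left hApos.ne'
  have hAre : A.re * √(ε ^ 2 + r ^ 2) = 2 * Real.pi := by
    have h1 := congrArg Complex.re hsq
    have e1 : ((ε : ℂ) ^ 2 + (r : ℂ) ^ 2) = ((ε ^ 2 + r ^ 2 : ℝ) : ℂ) := by push_cast; ring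
    have e2 : ((2 * Real.pi) ^ 2 : ℂ) = (((2 * Real.pi) ^ 2 : ℝ) : ℂ) := by push_cast; ring
    rw [e1, e2, Complex.re_mul_ofReal, Complex.ofReal_re, pow_two, Complex.mul_re, hAim] at h1
    refine (sq_eq_sq₀ (by positivity) (by positivity)).mp ?_
    rw [mul_pow, Real.sq_sqrt hpos.le]
    linarith
  have hint := integral_inv_circleDenom_sq hc0 r
  rw [← hA] at hint
  have hre := Complex.reCLM.intervalIntegral_comp_comm (μ := volume)
    ((continuous_inv_circleDenom_sq hc0 r).intervalIntegrable 0 (2 * Real.pi))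
  simp only [Complex.reCLM_apply] at hre
  rw [hre]
  have h1 := congrArg Complex.re hint
  have e1 : ((ε : ℂ) ^ 2 + (r : ℂ) ^ 2) = ((ε ^ 2 + r ^ 2 : ℝ) : ℂ) := by push_cast; ring
  rw [e1, Complex.re_ofReal_mul, Complex.re_ofReal_mul] at h1
  have hs : 0 < √(ε ^ 2 + r ^ 2) := Real.sqrt_pos.mpr hpos
  generalize (∫ φ in (0 : ℝ)..2 * Real.pi, (circleDenom (ε : ℂ) r φ ^ 2)⁻¹).re = Q at h1 ⊢
  rw [← hAre]
  field_simp
  linarith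

/-! ### The Radon transform of the cosine hump -/

/-- The cosine hump as a function of the squared norm; the truncation at `1` makes it vanish
outside the unit disc. -/
noncomputable def cosRadial (ρ : ℝ) : ℝ := Real.cos (Real.pi / 2 * min ρ 1)

lemma cosRadial_of_one_le {ρ : ℝ} (h : 1 ≤ ρ) : cosRadial ρ = 0 := by
  simp [cosRadial, min_eq_right h]

lemma cosRadial_of_le_one {ρ : ℝ} (h : ρ ≤ 1) : cosRadial ρ = Real.cos (Real.pi / 2 * ρ) := by
  simp [cosRadial, min_eq_left h]

lemma cosHump_eq (x : Plane) : cosHump x = cosRadial (x 0 ^ 2 + x 1 ^ 2) := by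
  unfold cosHump
  split_ifs with h
  · rw [cosRadial_of_le_one h.le]; congr 1; ring
  · rw [cosRadial_of_one_le (not_lt.mp h)]

lemma continuous_cosRadial : Continuous cosRadial := by
  unfold cosRadial; fun_prop

lemma cosRadial_nonneg {ρ : ℝ} (h : 0 ≤ ρ) : 0 ≤ cosRadial ρ := by
  have hpi := Real.pi_pos
  have h0 : 0 ≤ min ρ 1 := le_min h zero_le_one
  have h1 : min ρ 1 ≤ 1 := min_le_right _ _
  refine Real.cos_nonneg_of_neg_pi_div_two_le_of_le ?_ ?_ <;> nlinarith

lemma abs_cosRadial_sub_le (a b : ℝ) :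
    |cosRadial a - cosRadial b| ≤ Real.pi / 2 * |a - b| := by
  have h1 : |cosRadial a - cosRadial b| ≤
      |Real.pi / 2 * min a 1 - Real.pi / 2 * min b 1| := by
    simpa [Real.dist_eq, cosRadial] using Real.lipschitzWith_cos.dist_le_mul
      (Real.pi / 2 * min a 1) (Real.pi / 2 * min b 1)
  refine h1.trans ?_
  rw [← mul_sub, abs_mul, abs_of_pos (by positivity : (0 : ℝ) < Real.pi / 2)]
  refine mul_le_mul_of_nonneg_left ?_ (by positivity)
  simpa using abs_inf_sub_inf_le_abs a b 1

/-- The Radon transform of the cosine hump, which is the same in all directions. -/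
noncomputable def humpRadon (s : ℝ) : ℝ := ∫ τ : ℝ, cosRadial (s ^ 2 + τ ^ 2)

lemma radon_cosHump {ω : Plane} (hω : ‖ω‖ = 1) : radon cosHump ω = humpRadon := by
  have h1 : ω 0 ^ 2 + ω 1 ^ 2 = 1 := by
    have := EuclideanSpace.norm_sq_eq ω
    rw [hω, Fin.sum_univ_two] at this
    simpa using this.symm
  funext s
  unfold radon humpRadon
  congr 1
  funext τ
  rw [cosHump_eq]
  congr 1
  simp only [rot, PiLp.add_apply, PiLp.smul_apply, smul_eq_mul, Matrix.cons_val_zero,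
    Matrix.cons_val_one]
  linear_combination (s ^ 2 + τ ^ 2) * h1

lemma humpRadon_of_one_le {s : ℝ} (h : 1 ≤ |s|) : humpRadon s = 0 := by
  unfold humpRadon
  rw [show (fun τ : ℝ => cosRadial (s ^ 2 + τ ^ 2)) = fun _ => 0 from ?_, integral_zero]
  funext τ
  refine cosRadial_of_one_le ?_
  nlinarith [sq_abs s, sq_nonneg τ]

lemma integrable_cosRadial_slice (s : ℝ) : Integrable fun τ : ℝ => cosRadial (s ^ 2 + τ ^ 2) := by
  refine (continuous_cosRadial.comp (by fun_prop)).integrable_of_hasCompactSupport ?_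
  refine HasCompactSupport.intro (isCompact_Icc (a := (-1 : ℝ)) (b := 1)) fun τ hτ => ?_
  refine cosRadial_of_one_le ?_
  have : 1 < |τ| := not_le.mp fun h => hτ (abs_le.mp h)
  nlinarith [sq_abs τ, sq_nonneg s]

/-- The derivative of the integrand of `humpRadon` in the offset `s`. -/
noncomputable def humpSlope (s τ : ℝ) : ℝ :=
  if s ^ 2 + τ ^ 2 < 1 then -(Real.pi * s) * Real.sin (Real.pi / 2 * (s ^ 2 + τ ^ 2)) else 0

lemma measurable_humpSlope (s : ℝ) : Measurable (humpSlope s) := by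
  unfold humpSlope
  refine Measurable.ite ?_ (by fun_prop) measurable_const
  exact measurableSet_lt (by fun_prop) measurable_const

lemma hasDerivAt_cosRadial_slice {s τ : ℝ} (h : s ^ 2 + τ ^ 2 ≠ 1) :
    HasDerivAt (fun s => cosRadial (s ^ 2 + τ ^ 2)) (humpSlope s τ) s := by
  have hcont : Continuous fun s : ℝ => s ^ 2 + τ ^ 2 := by fun_prop
  rcases lt_or_gt_of_ne h with h | h
  · have hev : (fun s => cosRadial (s ^ 2 + τ ^ 2)) =ᶠ[𝓝 s]
        fun s => Real.cos (Real.pi / 2 * (s ^ 2 + τ ^ 2)) := by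
      filter_upwards [hcont.continuousAt.eventually_lt_const h] with y hy
      exact cosRadial_of_le_one hy.le
    refine HasDerivAt.congr_of_eventuallyEq ?_ hev
    have h1 : HasDerivAt (fun s : ℝ => Real.pi / 2 * (s ^ 2 + τ ^ 2))
        (Real.pi / 2 * (2 * s)) s := by
      simpa using (((hasDerivAt_id s).fun_pow 2).add_const (τ ^ 2)).const_mul (Real.pi / 2)
    refine h1.cos.congr_deriv ?_
    rw [humpSlope, if_pos h]; ring
  · have hev : (fun s => cosRadial (s ^ 2 + τ ^ 2)) =ᶠ[𝓝 s] fun _ => 0 := by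
      filter_upwards [hcont.continuousAt.eventually_const_lt h] with y hy
      exact cosRadial_of_one_le (le_of_lt hy)
    refine HasDerivAt.congr_of_eventuallyEq ?_ hev
    rw [humpSlope, if_neg (not_lt.mpr h.le)]
    exact hasDerivAt_const s 0

lemma hasDerivAt_humpRadon (s : ℝ) : HasDerivAt humpRadon (∫ τ, humpSlope s τ) s := by
  refine (hasDerivAt_integral_of_dominated_loc_of_lip (F := fun s τ => cosRadial (s ^ 2 + τ ^ 2))
    (bound := (Icc (-1 : ℝ) 1).indicator fun _ => Real.pi * (|s| + 1))
    (Metric.ball_mem_nhds s one_pos)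
    (Eventually.of_forall fun s => (integrable_cosRadial_slice s).aestronglyMeasurable)
    (integrable_cosRadial_slice s) (measurable_humpSlope s).aestronglyMeasurable
    (ae_of_all _ fun τ => ?_) ?_ ?_).2
  · refine LipschitzOnWith.of_dist_le_mul fun y hy z hz => ?_
    rw [Metric.mem_ball, Real.dist_eq] at hy hz
    rw [Real.dist_eq, Real.dist_eq, Real.coe_nnabs]
    by_cases hτ : τ ∈ Icc (-1 : ℝ) 1
    · rw [indicator_of_mem hτ, abs_of_nonneg (by positivity : 0 ≤ Real.pi * (|s| + 1))]
      refine (abs_cosRadial_sub_le _ _).trans ?_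
      have e : y ^ 2 + τ ^ 2 - (z ^ 2 + τ ^ 2) = (y + z) * (y - z) := by ring
      have h1 : |y + z| ≤ 2 * (|s| + 1) := by
        have := abs_add_le (y - s + (z - s)) (2 * s)
        have h2 := abs_add_le (y - s) (z - s)
        rw [show y - s + (z - s) + 2 * s = y + z by ring, abs_mul, abs_two] at this
        linarith
      rw [e, abs_mul]
      calc Real.pi / 2 * (|y + z| * |y - z|) ≤ Real.pi / 2 * (2 * (|s| + 1) * |y - z|) := by
            gcongr
        _ = _ := by ring
    · have h1 : 1 < |τ| := not_le.mp fun h => hτ (abs_le.mp h)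
      have h2 : 1 ≤ τ ^ 2 := by nlinarith [sq_abs τ]
      rw [cosRadial_of_one_le (by nlinarith [sq_nonneg y]),
        cosRadial_of_one_le (by nlinarith [sq_nonneg z]), sub_self, abs_zero]
      positivity
  · exact (integrable_indicator_iff measurableSet_Icc).mpr (integrableOn_const (by simp))
  · have hfin : ({√(1 - s ^ 2), -√(1 - s ^ 2)} : Set ℝ).Finite := toFinite _
    filter_upwards [hfin.countable.ae_notMem volume] with τ hτ
    refine hasDerivAt_cosRadial_slice fun h => hτ ?_
    have h1 : √(1 - s ^ 2) ^ 2 = τ ^ 2 := by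
      rw [Real.sq_sqrt (by nlinarith [sq_nonneg τ])]; linarith
    rcases sq_eq_sq_iff_eq_or_eq_neg.mp h1.symm with h2 | h2
    · exact Or.inl h2
    · exact Or.inr h2

lemma continuous_humpRadon : Continuous humpRadon :=
  continuous_iff_continuousAt.mpr fun _ => (hasDerivAt_humpRadon _).continuousAt

lemma hasCompactSupport_humpRadon : HasCompactSupport humpRadon :=
  HasCompactSupport.intro (isCompact_Icc (a := (-1 : ℝ)) (b := 1)) fun _ hs =>
    humpRadon_of_one_le (not_le.mp fun h => hs (abs_le.mp h)).le

lemma deriv_humpRadon_of_one_le {s : ℝ} (h : 1 ≤ |s|) : deriv humpRadon s = 0 := by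
  rw [(hasDerivAt_humpRadon s).deriv, show humpSlope s = fun _ => 0 from ?_, integral_zero]
  funext τ
  rw [humpSlope, if_neg]
  nlinarith [sq_abs s, sq_nonneg τ]

lemma abs_deriv_humpRadon_le (s : ℝ) : |deriv humpRadon s| ≤ 2 * Real.pi := by
  by_cases hs : 1 ≤ |s|
  · rw [deriv_humpRadon_of_one_le hs, abs_zero]; positivity
  rw [(hasDerivAt_humpRadon s).deriv]
  have h : ∀ τ, ‖humpSlope s τ‖ ≤ (Icc (-1 : ℝ) 1).indicator (fun _ => Real.pi) τ := fun τ => by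
    rw [humpSlope]
    split_ifs with h1
    · have hτ : τ ∈ Icc (-1 : ℝ) 1 :=
        abs_le.mp (by nlinarith [sq_abs τ, sq_nonneg s, abs_nonneg τ])
      rw [indicator_of_mem hτ, norm_mul, norm_neg, norm_mul, Real.norm_of_nonneg Real.pi_pos.le]
      calc Real.pi * ‖s‖ * ‖Real.sin (Real.pi / 2 * (s ^ 2 + τ ^ 2))‖
          ≤ Real.pi * 1 * 1 := by
            gcongr
            · exact (not_le.mp hs).le
            · exact Real.abs_sin_le_one _
        _ = Real.pi := by ring
    · rw [norm_zero]
      exact indicator_nonneg (fun _ _ => Real.pi_pos.le) τ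
  refine (norm_integral_le_of_norm_le ?_ (ae_of_all _ h)).trans (le_of_eq ?_)
  · exact (integrable_indicator_iff measurableSet_Icc).mpr (integrableOn_const (by simp))
  · rw [integral_indicator measurableSet_Icc, setIntegral_const]
    simp; norm_num

lemma integrable_deriv_humpRadon : Integrable (deriv humpRadon) := by
  have hb : Integrable ((Icc (-1 : ℝ) 1).indicator fun _ => 2 * Real.pi) :=
    (integrable_indicator_iff measurableSet_Icc).mpr (integrableOn_const (by simp))
  refine hb.mono' (measurable_deriv _).aestronglyMeasurable (ae_of_all _ fun s => ?_)
  by_cases hs : s ∈ Icc (-1 : ℝ) 1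
  · rw [indicator_of_mem hs]; exact abs_deriv_humpRadon_le s
  · rw [indicator_of_notMem hs, deriv_humpRadon_of_one_le (not_le.mp fun h => hs (abs_le.mp h)).le,
      norm_zero]

lemma humpRadon_zero_ge : 4 / 3 ≤ humpRadon 0 := by
  have h1 : ∫ τ in (-1 : ℝ)..1, (1 - τ ^ 2) = 4 / 3 := by
    rw [intervalIntegral.integral_sub (by simp) (by
      exact (continuous_pow 2).intervalIntegrable _ _), integral_pow]
    norm_num
  have hint := integrable_cosRadial_slice 0
  rw [← h1, humpRadon, intervalIntegral.integral_of_le (by norm_num)]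
  refine le_trans (setIntegral_mono_on ?_ hint.integrableOn measurableSet_Ioc fun τ hτ => ?_)
    (setIntegral_le_integral hint (ae_of_all _ fun τ => cosRadial_nonneg (by positivity)))
  · exact (Continuous.integrableOn_Icc (by fun_prop)).mono_set Ioc_subset_Icc_self
  · have h2 : τ ^ 2 ≤ 1 := by nlinarith [hτ.1, hτ.2]
    have hpi := Real.pi_pos
    rw [zero_pow two_ne_zero, zero_add, cosRadial_of_le_one h2]
    have h3 := Real.one_sub_mul_le_cos (x := Real.pi / 2 * τ ^ 2) (by positivity)
      (by nlinarith)
    have h4 : 2 / Real.pi * (Real.pi / 2 * τ ^ 2) = τ ^ 2 := by field_simp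
    linarith

/-- The total variation of the Radon transform is at least twice its value at the origin. -/
lemma integral_abs_deriv_humpRadon_ge : 8 / 3 ≤ ∫ z : ℝ, |deriv humpRadon z| := by
  have hi := integrable_deriv_humpRadon
  have hftc : ∀ a b : ℝ, ∫ z in a..b, deriv humpRadon z = humpRadon b - humpRadon a := fun a b =>
    intervalIntegral.integral_deriv_eq_sub
      (fun _ _ => (hasDerivAt_humpRadon _).differentiableAt) hi.intervalIntegrable
  have h1 : humpRadon 0 ≤ ∫ z in (-1 : ℝ)..0, |deriv humpRadon z| := by
    have := intervalIntegral.abs_integral_le_integral_abs (μ := volume) (f := deriv humpRadon)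
      (show (-1 : ℝ) ≤ 0 by norm_num)
    rw [hftc, humpRadon_of_one_le (s := -1) (by simp), sub_zero] at this
    exact (le_abs_self _).trans this
  have h2 : humpRadon 0 ≤ ∫ z in (0 : ℝ)..1, |deriv humpRadon z| := by
    have := intervalIntegral.abs_integral_le_integral_abs (μ := volume) (f := deriv humpRadon)
      (show (0 : ℝ) ≤ 1 by norm_num)
    rw [hftc, humpRadon_of_one_le (s := 1) (by simp), zero_sub, abs_neg] at this
    exact (le_abs_self _).trans this
  have h3 := intervalIntegral.integral_add_adjacent_intervals
    (hi.abs.intervalIntegrable (a := -1) (b := 0)) (hi.abs.intervalIntegrable (a := 0) (b := 1))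
  have h4 : ∫ z in (-1 : ℝ)..1, |deriv humpRadon z| ≤ ∫ z, |deriv humpRadon z| := by
    rw [intervalIntegral.integral_of_le (by norm_num)]
    exact setIntegral_le_integral hi.abs (ae_of_all _ fun _ => abs_nonneg _)
  linarith [humpRadon_zero_ge]

/-- The linear functional `x ↦ ⟪ω, x⟫` for the direction `ω` at angle `θ`. -/
noncomputable def dirCoord (θ : ℝ) (x : Plane) : ℝ := Real.cos θ * x 0 + Real.sin θ * x 1

lemma continuous_dirCoord : Continuous fun z : ℝ × Plane => dirCoord z.1 z.2 := by
  unfold dirCoord; fun_prop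

/-- The rotation of the plane that turns the direction at angle `θ` into the first axis. -/
noncomputable def planeRotation (θ : ℝ) : Plane ≃ₗᵢ[ℝ] Plane :=
  LinearIsometry.toLinearIsometryEquiv
    { toLinearMap :=
        { toFun := fun x => !₂[dirCoord θ x, -Real.sin θ * x 0 + Real.cos θ * x 1]
          map_add' := fun x y => by
            ext i; fin_cases i <;> simp [dirCoord] <;> ring
          map_smul' := fun a x => by
            ext i; fin_cases i <;> simp [dirCoord] <;> ring }
      norm_map' := fun x => by
        rw [EuclideanSpace.norm_eq, EuclideanSpace.norm_eq, Fin.sum_univ_two, Fin.sum_univ_two]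
        congr 1
        simp only [LinearMap.coe_mk, AddHom.coe_mk, Real.norm_eq_abs, sq_abs,
          Matrix.cons_val_zero, Matrix.cons_val_one, dirCoord]
        linear_combination (x 0 ^ 2 + x 1 ^ 2) * Real.sin_sq_add_cos_sq θ } rfl

lemma planeRotation_apply (θ : ℝ) (x : Plane) :
    planeRotation θ x = !₂[dirCoord θ x, -Real.sin θ * x 0 + Real.cos θ * x 1] := rfl

lemma integral_plane_eq_integral_prod (f : ℝ × ℝ → ℝ) :
    ∫ x : Plane, f (x 0, x 1) = ∫ z : ℝ × ℝ, f z := by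
  have h := (volume_preserving_finTwoArrow ℝ).comp (PiLp.volume_preserving_ofLp (Fin 2))
  have he : MeasurableEmbedding
      (⇑(MeasurableEquiv.finTwoArrow (α := ℝ)) ∘ (WithLp.ofLp : Plane → Fin 2 → ℝ)) :=
    (MeasurableEquiv.finTwoArrow (α := ℝ)).measurableEmbedding.comp
      (MeasurableEquiv.toLp 2 (Fin 2 → ℝ)).symm.measurableEmbedding
  exact h.integral_comp he f

/-- The Fourier-slice principle in physical space: integrating the hump against a plane wave
reduces to integrating its Radon transform against the profile. -/
lemma integral_cosHump_mul_comp_dirCoord {w : ℝ → ℝ} (hw : Continuous w) (θ : ℝ) :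
    ∫ x : Plane, cosHump x * w (dirCoord θ x) = ∫ z, humpRadon z * w z := by
  have hT := (planeRotation θ).measurePreserving.integral_comp
    (planeRotation θ).toHomeomorph.measurableEmbedding (fun x => cosHump x * w (x 0))
  have e : ∀ x, cosHump (planeRotation θ x) * w (planeRotation θ x 0) =
      cosHump x * w (dirCoord θ x) := fun x => by
    rw [cosHump_eq, cosHump_eq, planeRotation_apply]
    simp only [Matrix.cons_val_zero, Matrix.cons_val_one]
    congr 2
    unfold dirCoord
    linear_combination (x 0 ^ 2 + x 1 ^ 2) * Real.sin_sq_add_cos_sq θ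
  simp only [e] at hT
  rw [hT]
  simp only [cosHump_eq]
  rw [integral_plane_eq_integral_prod fun z => cosRadial (z.1 ^ 2 + z.2 ^ 2) * w z.1,
    Measure.volume_eq_prod, integral_prod]
  · refine integral_congr_ae (ae_of_all _ fun z => ?_)
    simp only
    rw [integral_mul_const]; rfl
  · rw [← Measure.volume_eq_prod]
    refine Continuous.integrable_of_hasCompactSupport ?_ ?_
    · exact (continuous_cosRadial.comp (by fun_prop)).mul (hw.comp continuous_fst)
    · refine HasCompactSupport.intro ((isCompact_Icc (a := (-1 : ℝ)) (b := 1)).prod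
        (isCompact_Icc (a := (-1 : ℝ)) (b := 1))) fun z hz => ?_
      rw [cosRadial_of_one_le, zero_mul]
      by_contra h
      refine hz ⟨abs_le.mp ?_, abs_le.mp ?_⟩ <;>
        nlinarith [sq_abs z.1, sq_abs z.2, abs_nonneg z.1, abs_nonneg z.2, sq_nonneg z.1,
          sq_nonneg z.2]

lemma continuous_cosHump : Continuous cosHump := by
  rw [show cosHump = fun x => cosRadial (x 0 ^ 2 + x 1 ^ 2) from funext cosHump_eq]
  exact continuous_cosRadial.comp (by fun_prop)

lemma integrable_cosHump : Integrable cosHump := by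
  refine continuous_cosHump.integrable_of_hasCompactSupport
    (HasCompactSupport.intro (isCompact_closedBall (0 : Plane) 1) fun x hx => ?_)
  rw [Metric.mem_closedBall, dist_zero_right, not_le] at hx
  rw [cosHump_eq, cosRadial_of_one_le]
  have := EuclideanSpace.norm_sq_eq x
  rw [Fin.sum_univ_two] at this
  simp only [Real.norm_eq_abs, sq_abs] at this
  nlinarith

/-! ### Plane-wave moments of the solution -/

/-- The integral of `f` against the plane wave with profile `planeKernel ε` in the direction at
angle `θ` with offset `c`. -/
noncomputable def planeMoment (ε : ℝ) (f : Plane → ℝ) (θ c : ℝ) : ℝ :=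
  ∫ x : Plane, planeKernel ε (dirCoord θ x - c) * f x

lemma continuous_dirCoord_right (θ : ℝ) : Continuous (dirCoord θ) := by
  unfold dirCoord; fun_prop

lemma integrable_planeKernel_mul {ε : ℝ} (hε : 0 < ε) {f : Plane → ℝ} (hf : Integrable f)
    (θ c : ℝ) : Integrable fun x => planeKernel ε (dirCoord θ x - c) * f x :=
  hf.bdd_mul (((contDiff_planeKernel hε).continuous.comp
    ((continuous_dirCoord_right θ).sub continuous_const)).aestronglyMeasurable)
    (ae_of_all _ fun _ => abs_planeKernel_le hε _)

lemma continuous_planeMoment {ε : ℝ} (hε : 0 < ε) {f : Plane → ℝ} (hf : Integrable f) :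
    Continuous fun p : ℝ × ℝ => planeMoment ε f p.1 p.2 := by
  refine continuous_of_dominated (bound := fun x => (ε ^ 2)⁻¹ * |f x|)
    (fun p => (integrable_planeKernel_mul hε hf p.1 p.2).aestronglyMeasurable)
    (fun p => ae_of_all _ fun x => ?_) (hf.abs.const_mul _) (ae_of_all _ fun x => ?_)
  · rw [norm_mul]
    exact mul_le_mul_of_nonneg_right (abs_planeKernel_le hε _) (abs_nonneg _)
  · refine Continuous.mul ((contDiff_planeKernel hε).continuous.comp ?_) continuous_const
    exact (continuous_dirCoord.comp (continuous_fst.prodMk continuous_const)).sub continuous_snd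

lemma dirCoord_add_pi (θ : ℝ) (x : Plane) : dirCoord (θ + Real.pi) x = -dirCoord θ x := by
  simp only [dirCoord, Real.cos_add_pi, Real.sin_add_pi]; ring

lemma planeMoment_add_pi (ε : ℝ) (f : Plane → ℝ) (θ c : ℝ) :
    planeMoment ε f (θ + Real.pi) (-c) = planeMoment ε f θ c := by
  unfold planeMoment
  refine integral_congr_ae (ae_of_all _ fun x => ?_)
  simp only [dirCoord_add_pi]
  rw [← planeKernel_neg]
  congr 2; ring

lemma integrable_cosHumpState : Integrable cosHumpState := by
  refine Integrable.of_eval fun i => ?_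
  fin_cases i
  · exact integrable_cosHump
  · exact integrable_zero _ _ _
  · exact integrable_zero _ _ _

section
variable {q : ℝ → Plane → Fin 3 → ℝ}

/-- If the phase `L` and the polarization `ℓ` satisfy the dispersion relation of the acoustic
equations, the corresponding moments of the solution do not depend on time. -/
lemma IsAcousticSolution.ae_integral_planeKernel_eq (hq : IsAcousticSolution 1 1 cosHumpState q)
    (L : ℝ × Plane →L[ℝ] ℝ) (ℓ : (Fin 3 → ℝ) →L[ℝ] ℝ)
    (hL : ∀ v, ℓ (acousticPairing 1 1 L v) = 0) {ε : ℝ} (hε : 0 < ε) (κ : ℝ) :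
    ∀ᵐ t : ℝ, 0 < t → ∫ x : Plane, planeKernel ε (L (t, x) - κ) * ℓ (q t x) =
      ∫ x : Plane, planeKernel ε (L (0, x) - κ) * ℓ (cosHumpState x) := by
  obtain ⟨B, hB⟩ := exists_abs_deriv_planeKernel_le hε
  have hw := contDiff_planeKernel hε
  have hfd : ∀ z, HasFDerivAt (fun z => planeKernel ε (L z - κ))
      (deriv (planeKernel ε) (L z - κ) • L) z := fun z => by
    have h : HasDerivAt (planeKernel ε) (deriv (planeKernel ε) (L z - κ)) (L z - κ) :=
      (hw.differentiable (by simp) (L z - κ)).hasDerivAt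
    exact h.comp_hasFDerivAt z (L.hasFDerivAt.sub_const κ)
  have hB0 : 0 ≤ B := (abs_nonneg _).trans (hB 0)
  refine hq.ae_integral_eq integrable_cosHumpState ℓ (W := fun z => planeKernel ε (L z - κ))
    (M := (ε ^ 2)⁻¹ + B * ‖L‖)
    (hw.comp (L.contDiff.sub contDiff_const)) (fun z => ?_) (fun z => ?_) fun z v => ?_
  · exact (abs_planeKernel_le hε _).trans (le_add_of_nonneg_right (by positivity))
  · rw [(hfd z).fderiv, norm_smul]
    exact (mul_le_mul_of_nonneg_right (hB _) (norm_nonneg _)).trans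
      (le_add_of_nonneg_left (by positivity))
  · rw [(hfd z).fderiv, acousticPairing_smul, map_smul, hL, smul_zero]

/-- `dirCoord θ` as a continuous linear functional. -/
noncomputable def dirCLM (θ : ℝ) : Plane →L[ℝ] ℝ :=
  Real.cos θ • EuclideanSpace.proj 0 + Real.sin θ • EuclideanSpace.proj 1

lemma dirCLM_apply (θ : ℝ) (x : Plane) : dirCLM θ x = dirCoord θ x := by
  simp [dirCLM, dirCoord]

/-- The travelling wave in direction `θ`. -/
lemma IsAcousticSolution.ae_planeMoment_longitudinal
    (hq : IsAcousticSolution 1 1 cosHumpState q) {ε : ℝ} (hε : 0 < ε) (θ κ : ℝ) :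
    ∀ᵐ t : ℝ, 0 < t → Integrable (q t) →
      planeMoment ε (fun x => q t x 0) θ (t + κ) +
        Real.cos θ * planeMoment ε (fun x => q t x 1) θ (t + κ) +
        Real.sin θ * planeMoment ε (fun x => q t x 2) θ (t + κ) =
      planeMoment ε cosHump θ κ := by
  let L : ℝ × Plane →L[ℝ] ℝ :=
    (dirCLM θ).comp (ContinuousLinearMap.snd ℝ ℝ Plane) - ContinuousLinearMap.fst ℝ ℝ Plane
  let ℓ : (Fin 3 → ℝ) →L[ℝ] ℝ := ContinuousLinearMap.proj 0 +
    Real.cos θ • ContinuousLinearMap.proj 1 + Real.sin θ • ContinuousLinearMap.proj 2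
  have hLa : ∀ t x, L (t, x) = dirCoord θ x - t := fun t x => by simp [L, dirCLM_apply]
  have hℓa : ∀ v, ℓ v = v 0 + Real.cos θ * v 1 + Real.sin θ * v 2 := fun v => by simp [ℓ]
  have hL : ∀ v, ℓ (acousticPairing 1 1 L v) = 0 := fun v => by
    simp only [acousticPairing, hLa, hℓa, Fin.sum_univ_two, acousticMatrix, dirCoord]
    simp [dotProduct, Fin.sum_univ_three]
    linear_combination v 0 * Real.sin_sq_add_cos_sq θ
  filter_upwards [hq.ae_integral_planeKernel_eq L ℓ hL hε κ] with t ht h0 hint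
  have h := ht h0
  have hi : ∀ i, Integrable fun x => q t x i := fun i => hint.eval i
  have m := fun i => integrable_planeKernel_mul hε (hi i) θ (t + κ)
  simp only [hLa, hℓa] at h
  unfold planeMoment
  have m1 : Integrable fun x => planeKernel ε (dirCoord θ x - (t + κ)) * q t x 0 +
      Real.cos θ * (planeKernel ε (dirCoord θ x - (t + κ)) * q t x 1) :=
    (m 0).add ((m 1).const_mul _)
  rw [← integral_const_mul, ← integral_const_mul, ← integral_add (m 0) ((m 1).const_mul _),
    ← integral_add m1 ((m 2).const_mul _)]
  simp only [cosHumpState, Matrix.cons_val, mul_zero, add_zero, sub_zero] at h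
  rw [← h]
  refine integral_congr_ae (ae_of_all _ fun x => ?_)
  simp only [sub_sub]
  ring

/-- The standing transverse wave in direction `θ`, which the data do not excite. -/
lemma IsAcousticSolution.ae_planeMoment_transverse
    (hq : IsAcousticSolution 1 1 cosHumpState q) {ε : ℝ} (hε : 0 < ε) (θ κ : ℝ) :
    ∀ᵐ t : ℝ, 0 < t → Integrable (q t) →
      Real.cos θ * planeMoment ε (fun x => q t x 2) θ κ =
        Real.sin θ * planeMoment ε (fun x => q t x 1) θ κ := by
  let L : ℝ × Plane →L[ℝ] ℝ := (dirCLM θ).comp (ContinuousLinearMap.snd ℝ ℝ Plane)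
  let ℓ : (Fin 3 → ℝ) →L[ℝ] ℝ :=
    Real.cos θ • ContinuousLinearMap.proj 2 - Real.sin θ • ContinuousLinearMap.proj 1
  have hLa : ∀ t x, L (t, x) = dirCoord θ x := fun t x => by simp [L, dirCLM_apply]
  have hℓa : ∀ v, ℓ v = Real.cos θ * v 2 - Real.sin θ * v 1 := fun v => by simp [ℓ]
  have hL : ∀ v, ℓ (acousticPairing 1 1 L v) = 0 := fun v => by
    simp only [acousticPairing, hLa, hℓa, Fin.sum_univ_two, acousticMatrix, dirCoord]
    simp [dotProduct, Fin.sum_univ_three]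
    ring
  filter_upwards [hq.ae_integral_planeKernel_eq L ℓ hL hε κ] with t ht h0 hint
  have h := ht h0
  have hi : ∀ i, Integrable fun x => q t x i := fun i => hint.eval i
  have m := fun i => integrable_planeKernel_mul hε (hi i) θ κ
  simp only [hLa, hℓa] at h
  unfold planeMoment
  rw [← sub_eq_zero, ← integral_const_mul, ← integral_const_mul,
    ← integral_sub ((m 2).const_mul _) ((m 1).const_mul _)]
  simp only [cosHumpState, Matrix.cons_val, mul_zero, sub_zero, integral_zero] at h
  rw [← h]
  refine integral_congr_ae (ae_of_all _ fun x => ?_)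
  simp only
  ring

lemma IsAcousticSolution.ae_integrable (hq : IsAcousticSolution 1 1 cosHumpState q) :
    ∀ᵐ t : ℝ, 0 < t → Integrable (q t) := by
  have h : ∀ n : ℕ, ∀ᵐ t : ℝ, t ∈ Icc (0 : ℝ) n → Integrable (q t) := fun n => by
    have h1 := hq.integrableOn n
    rw [IntegrableOn, Measure.volume_eq_prod, ← Measure.prod_restrict, Measure.restrict_univ] at h1
    exact (ae_restrict_iff' measurableSet_Icc).mp h1.prod_right_ae
  filter_upwards [ae_all_iff.mpr h] with t ht h0
  obtain ⟨n, hn⟩ := exists_nat_ge t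
  exact ht n ⟨h0.le, hn⟩

/-- At almost every time, all plane-wave moments of the solution are those of the d'Alembert
solution in the respective direction, simultaneously for all directions and offsets: both sides
are continuous in these parameters, so a countable dense set of them suffices. -/
lemma IsAcousticSolution.ae_forall_planeMoment (hq : IsAcousticSolution 1 1 cosHumpState q) :
    ∀ᵐ t : ℝ, 0 < t → Integrable (q t) ∧ ∀ (n : ℕ) (θ c : ℝ),
      (planeMoment (1 / ((n : ℝ) + 1)) (fun x => q t x 0) θ c +
        Real.cos θ * planeMoment (1 / ((n : ℝ) + 1)) (fun x => q t x 1) θ c +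
        Real.sin θ * planeMoment (1 / ((n : ℝ) + 1)) (fun x => q t x 2) θ c =
      planeMoment (1 / ((n : ℝ) + 1)) cosHump θ (c - t)) ∧
      Real.cos θ * planeMoment (1 / ((n : ℝ) + 1)) (fun x => q t x 2) θ c =
        Real.sin θ * planeMoment (1 / ((n : ℝ) + 1)) (fun x => q t x 1) θ c := by
  let d : ℕ → ℝ × ℝ := TopologicalSpace.denseSeq (ℝ × ℝ)
  have hd : DenseRange d := TopologicalSpace.denseRange_denseSeq _
  have hε : ∀ n : ℕ, (0 : ℝ) < 1 / ((n : ℝ) + 1) := fun n => by positivity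
  have h1 := ae_all_iff.mpr fun n : ℕ => ae_all_iff.mpr fun k : ℕ =>
    hq.ae_planeMoment_longitudinal (hε n) (d k).1 (d k).2
  have h2 := ae_all_iff.mpr fun n : ℕ => ae_all_iff.mpr fun k : ℕ =>
    hq.ae_planeMoment_transverse (hε n) (d k).1 (d k).2
  filter_upwards [h1, h2, hq.ae_integrable] with t ht1 ht2 ht h0
  have hint := ht h0
  refine ⟨hint, fun n θ c => ?_⟩
  have hc : ∀ i, Continuous fun p : ℝ × ℝ =>
      planeMoment (1 / ((n : ℝ) + 1)) (fun x => q t x i) p.1 p.2 := fun i =>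
    continuous_planeMoment (hε n) (hint.eval i)
  have hc' : ∀ i, Continuous fun p : ℝ × ℝ =>
      planeMoment (1 / ((n : ℝ) + 1)) (fun x => q t x i) p.1 (t + p.2) := fun i =>
    (hc i).comp (continuous_fst.prodMk (continuous_const.add continuous_snd))
  have hcos : Continuous fun p : ℝ × ℝ => Real.cos p.1 := by fun_prop
  have hsin : Continuous fun p : ℝ × ℝ => Real.sin p.1 := by fun_prop
  constructor
  · have := hd.equalizer (((hc' 0).add (hcos.mul (hc' 1))).add (hsin.mul (hc' 2)))
      (continuous_planeMoment (hε n) integrable_cosHump)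
      (funext fun k => ht1 n k h0 hint)
    simpa using congrFun this (θ, c - t)
  · have := hd.equalizer (hcos.mul (hc 2)) (hsin.mul (hc 1)) (funext fun k => ht2 n k h0 hint)
    exact congrFun this (θ, c)
end

/-! ### Poisson mollification -/

/-- The Poisson kernel of the upper half-space at height one over the plane. -/
noncomputable def poissonPlane (x : Plane) : ℝ :=
  1 / (2 * Real.pi) * ((1 + ‖x‖ ^ 2) * √(1 + ‖x‖ ^ 2))⁻¹

lemma integral_poissonRadial :
    ∫ y in Ioi (0 : ℝ), y * ((1 + y ^ 2) * √(1 + y ^ 2))⁻¹ = 1 := by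
  have hd : ∀ y ∈ Ici (0 : ℝ), HasDerivAt (fun y : ℝ => -(√(1 + y ^ 2))⁻¹)
      (y * ((1 + y ^ 2) * √(1 + y ^ 2))⁻¹) y := fun y _ => by
    have hpos : 0 < 1 + y ^ 2 := by positivity
    have h := ((((hasDerivAt_id y).fun_pow 2).const_add 1).sqrt hpos.ne').fun_inv
      (Real.sqrt_pos.mpr hpos).ne' |>.fun_neg
    refine h.congr_deriv ?_
    have h2 := Real.sq_sqrt hpos.le
    have h3 : √(1 + y ^ 2) ≠ 0 := (Real.sqrt_pos.mpr hpos).ne'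
    simp only [id_eq, h2]
    field_simp
    norm_num
  have hlim : Tendsto (fun y : ℝ => -(√(1 + y ^ 2))⁻¹) atTop (𝓝 0) := by
    rw [← neg_zero]
    refine (tendsto_inv_atTop_zero.comp (Real.tendsto_sqrt_atTop.comp ?_)).neg
    exact tendsto_atTop_add_const_left _ _ (tendsto_pow_atTop two_ne_zero)
  rw [integral_Ioi_of_hasDerivAt_of_nonneg' hd (fun y hy => ?_) hlim]
  · simp
  · have : (0 : ℝ) < y := hy
    positivity

lemma integral_poissonPlane : ∫ x, poissonPlane x = 1 := by
  have h := integral_fun_norm_addHaar (volume : Measure Plane)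
    (fun ρ : ℝ => 1 / (2 * Real.pi) * ((1 + ρ ^ 2) * √(1 + ρ ^ 2))⁻¹)
  have hvol : (volume : Measure Plane).real (Metric.ball 0 1) = Real.pi := by
    rw [Measure.real, EuclideanSpace.volume_ball_fin_two]
    simp [Real.pi_pos.le]
  have h1 : ∫ y in Ioi (0 : ℝ), y ^ (2 - 1) • (1 / (2 * Real.pi) *
      ((1 + y ^ 2) * √(1 + y ^ 2))⁻¹) = 1 / (2 * Real.pi) := by
    calc _ = ∫ y in Ioi (0 : ℝ), 1 / (2 * Real.pi) * (y * ((1 + y ^ 2) * √(1 + y ^ 2))⁻¹) := by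
          refine setIntegral_congr_fun measurableSet_Ioi fun y _ => ?_
          simp only [smul_eq_mul]
          ring
      _ = _ := by rw [integral_const_mul, integral_poissonRadial, mul_one]
  rw [finrank_euclideanSpace_fin, hvol, h1] at h
  unfold poissonPlane
  rw [h]
  simp only [smul_eq_mul, nsmul_eq_mul]
  have := Real.pi_pos.ne'
  push_cast
  field_simp

lemma tendsto_sq_mul_poissonPlane :
    Tendsto (fun x : Plane => ‖x‖ ^ Module.finrank ℝ Plane * poissonPlane x)
      (Bornology.cobounded Plane) (𝓝 0) := by
  have hlim : Tendsto (fun x : Plane => 1 / (2 * Real.pi) * (√(1 + ‖x‖ ^ 2))⁻¹)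
      (Bornology.cobounded Plane) (𝓝 0) := by
    rw [← mul_zero (1 / (2 * Real.pi))]
    refine (tendsto_inv_atTop_zero.comp (Real.tendsto_sqrt_atTop.comp ?_)).const_mul _
    exact tendsto_atTop_add_const_left _ _
      ((tendsto_pow_atTop two_ne_zero).comp tendsto_norm_cobounded_atTop)
  refine squeeze_zero (fun x => ?_) (fun x => ?_) hlim
  · unfold poissonPlane; positivity
  · rw [finrank_euclideanSpace_fin]
    unfold poissonPlane
    rw [mul_left_comm, mul_inv, ← mul_assoc (‖x‖ ^ 2)]
    refine mul_le_mul_of_nonneg_left ?_ (by positivity)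
    refine mul_le_of_le_one_left (by positivity) ?_
    rw [← div_eq_mul_inv, div_le_one (by positivity)]
    linarith

/-- Poisson means of an integrable function converge at every point of continuity. -/
lemma tendsto_poisson_mean {f : Plane → ℝ} (hf : Integrable f) {x₀ : Plane}
    (hc : ContinuousAt f x₀) :
    Tendsto (fun n : ℕ => ∫ x, (2 * Real.pi * ((1 / ((n : ℝ) + 1)) /
      (((1 / ((n : ℝ) + 1)) ^ 2 + ‖x - x₀‖ ^ 2) *
        √((1 / ((n : ℝ) + 1)) ^ 2 + ‖x - x₀‖ ^ 2)))) * f x) atTop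
      (𝓝 ((2 * Real.pi) ^ 2 * f x₀)) := by
  have h := tendsto_integral_comp_smul_smul_of_integrable' (μ := volume) (φ := poissonPlane)
    (fun x => by unfold poissonPlane; positivity) integral_poissonPlane
    tendsto_sq_mul_poissonPlane hf hc
  have h1 : Tendsto (fun n : ℕ => (n : ℝ) + 1) atTop atTop :=
    tendsto_atTop_add_const_right _ _ tendsto_natCast_atTop_atTop
  refine ((h.comp h1).const_mul ((2 * Real.pi) ^ 2)).congr fun n => ?_
  simp only [Function.comp]
  rw [← integral_const_mul]
  refine integral_congr_ae (ae_of_all _ fun x => ?_)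
  simp only [smul_eq_mul]
  rw [← mul_assoc]
  congr 1
  have hN : (0 : ℝ) < (n : ℝ) + 1 := by positivity
  generalize (n : ℝ) + 1 = N at hN
  rw [poissonPlane, norm_smul, Real.norm_of_nonneg hN.le, norm_sub_rev, finrank_euclideanSpace_fin]
  have e : (1 / N) ^ 2 + ‖x - x₀‖ ^ 2 = (1 / N) ^ 2 * (1 + (N * ‖x - x₀‖) ^ 2) := by
    field_simp
  rw [e, Real.sqrt_mul (by positivity), Real.sqrt_sq (by positivity)]
  have hs : √(1 + (N * ‖x - x₀‖) ^ 2) ≠ 0 := (Real.sqrt_pos.mpr (by positivity)).ne'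
  have hpi := Real.pi_pos.ne'
  field_simp

lemma exists_dirCoord_eq (y : Plane) : ∃ α : ℝ, ∀ θ, dirCoord θ y = ‖y‖ * Real.cos (θ - α) := by
  let z : ℂ := ⟨y 0, y 1⟩
  have hz : ‖z‖ = ‖y‖ := by
    rw [EuclideanSpace.norm_eq, Fin.sum_univ_two, Complex.norm_def, Complex.normSq_apply]
    simp [z, pow_two]
  refine ⟨z.arg, fun θ => ?_⟩
  have h0 : ‖y‖ * Real.cos z.arg = y 0 := hz ▸ Complex.norm_mul_cos_arg z
  have h1 : ‖y‖ * Real.sin z.arg = y 1 := hz ▸ Complex.norm_mul_sin_arg z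
  rw [Real.cos_sub, dirCoord]
  linear_combination -Real.cos θ * h0 - Real.sin θ * h1

lemma dirCoord_sub (θ : ℝ) (x y : Plane) : dirCoord θ (x - y) = dirCoord θ x - dirCoord θ y := by
  simp only [dirCoord, PiLp.sub_apply]; ring

lemma isFiniteMeasure_restrict_uIoc (a b : ℝ) :
    IsFiniteMeasure (volume.restrict (uIoc a b)) := ⟨by simp [uIoc]⟩

lemma integral_planeMoment {ε : ℝ} (hε : 0 < ε) {f : Plane → ℝ} (hf : Integrable f)
    (x₀ : Plane) :
    ∫ θ in (0 : ℝ)..2 * Real.pi, planeMoment ε f θ (dirCoord θ x₀) =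
      ∫ x, (2 * Real.pi * (ε / ((ε ^ 2 + ‖x - x₀‖ ^ 2) * √(ε ^ 2 + ‖x - x₀‖ ^ 2)))) * f x := by
  unfold planeMoment
  have := isFiniteMeasure_restrict_uIoc 0 (2 * Real.pi)
  rw [intervalIntegral_integral_swap]
  · refine integral_congr_ae (ae_of_all _ fun x => ?_)
    obtain ⟨α, hα⟩ := exists_dirCoord_eq (x - x₀)
    simp only
    rw [intervalIntegral.integral_mul_const, ← integral_planeKernel_cos hε _ α]
    congr 1
    refine intervalIntegral.integral_congr fun θ _ => ?_
    simp only [← hα, dirCoord_sub]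
  · refine (hf.comp_snd (μ := volume.restrict (uIoc 0 (2 * Real.pi)))).bdd_mul
      (c := (ε ^ 2)⁻¹) ?_ (ae_of_all _ fun _ => abs_planeKernel_le hε _)
    refine Continuous.aestronglyMeasurable ((contDiff_planeKernel hε).continuous.comp ?_)
    exact continuous_dirCoord.sub
      (continuous_dirCoord.comp (continuous_fst.prodMk continuous_const))

/-- Slicing and integration by parts turn a plane-wave moment of the hump into an integral of the
derivative of its Radon transform. -/
lemma planeMoment_cosHump {ε : ℝ} (hε : 0 < ε) (θ c : ℝ) :
    planeMoment ε cosHump θ c = -∫ z, deriv humpRadon z * conjKernel ε (z - c) := by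
  have hw : Continuous fun z => planeKernel ε (z - c) :=
    (contDiff_planeKernel hε).continuous.comp (by fun_prop)
  have hk : Continuous fun z => conjKernel ε (z - c) :=
    (continuous_conjKernel hε).comp (by fun_prop)
  have h1 := integral_cosHump_mul_comp_dirCoord hw θ
  have h2 : planeMoment ε cosHump θ c = ∫ z, humpRadon z * planeKernel ε (z - c) := by
    rw [← h1]
    refine integral_congr_ae (ae_of_all _ fun x => ?_)
    simp only; ring
  rw [h2]
  refine integral_mul_deriv_eq_deriv_mul_of_integrable (u := humpRadon) (u' := deriv humpRadon)
    (v := fun z => conjKernel ε (z - c)) (v' := fun z => planeKernel ε (z - c))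
    (fun z _ => (hasDerivAt_humpRadon z).differentiableAt.hasDerivAt)
    (fun z _ => (hasDerivAt_conjKernel hε (z - c)).comp_sub_const z c) ?_ ?_ ?_
  · exact (continuous_humpRadon.mul hw).integrable_of_hasCompactSupport
      hasCompactSupport_humpRadon.mul_right
  · exact integrable_deriv_humpRadon.mul_bdd (c := ε⁻¹) hk.aestronglyMeasurable
      (ae_of_all _ fun _ => abs_conjKernel_le hε _)
  · exact (continuous_humpRadon.mul hk).integrable_of_hasCompactSupport
      hasCompactSupport_humpRadon.mul_right

/-- The mean over all directions of the d'Alembert moments of the hump is controlled by the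
derivative of its Radon transform, weighted by an inverse square root that is singular only on
the light cone. -/
lemma abs_integral_waveVec_mul_planeMoment_le {ε : ℝ} (hε : 0 < ε) (t : ℝ) (x₀ : Plane)
    (i : Fin 3) {H : ℝ → ℝ} (hH : Integrable H)
    (hle : ∀ z, t + z ≠ ‖x₀‖ → t + z ≠ -‖x₀‖ →
      |deriv humpRadon z| / √(|t + z + ‖x₀‖| * |t + z - ‖x₀‖|) ≤ H z) :
    |∫ θ in (0 : ℝ)..2 * Real.pi, waveVec θ i * planeMoment ε cosHump θ (dirCoord θ x₀ - t)| ≤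
      2 * Real.pi * ∫ z, H z := by
  obtain ⟨α, hα⟩ := exists_dirCoord_eq x₀
  have := isFiniteMeasure_restrict_uIoc 0 (2 * Real.pi)
  set r := ‖x₀‖
  have e : ∫ θ in (0 : ℝ)..2 * Real.pi, waveVec θ i * planeMoment ε cosHump θ (dirCoord θ x₀ - t) =
      -∫ z, deriv humpRadon z * ∫ θ in (0 : ℝ)..2 * Real.pi,
        waveVec θ i * conjKernel ε (t + z - r * Real.cos (θ - α)) := by
    calc _ = ∫ θ in (0 : ℝ)..2 * Real.pi, -∫ z, deriv humpRadon z *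
          (waveVec θ i * conjKernel ε (t + z - r * Real.cos (θ - α))) := by
          refine intervalIntegral.integral_congr fun θ _ => ?_
          rw [planeMoment_cosHump hε, mul_neg, ← integral_const_mul]
          congr 1
          refine integral_congr_ae (ae_of_all _ fun z => ?_)
          simp only [hα]
          rw [show z - (r * Real.cos (θ - α) - t) = t + z - r * Real.cos (θ - α) by ring]
          ring
      _ = _ := by
          rw [intervalIntegral.integral_neg, intervalIntegral_integral_swap]
          · simp only [intervalIntegral.integral_const_mul]
          · refine (integrable_deriv_humpRadon.comp_snd
              (μ := volume.restrict (uIoc 0 (2 * Real.pi)))).mul_bdd (c := 1 * ε⁻¹) ?_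
              (ae_of_all _ fun z => ?_)
            · refine Continuous.aestronglyMeasurable ?_
              exact ((continuous_waveVec i).comp continuous_fst).mul
                ((continuous_conjKernel hε).comp (by fun_prop))
            · rw [norm_mul]
              exact mul_le_mul (abs_waveVec_le _ i) (abs_conjKernel_le hε _) (abs_nonneg _)
                zero_le_one
  rw [e, abs_neg, ← integral_const_mul, ← Real.norm_eq_abs]
  refine norm_integral_le_of_norm_le (hH.const_mul _) ?_
  have hfin : ({r - t, -r - t} : Set ℝ).Finite := toFinite _
  filter_upwards [hfin.countable.ae_notMem volume] with z hz
  have h1 : t + z ≠ r := fun h => hz (Or.inl (by linarith))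
  have h2 : t + z ≠ -r := fun h => hz (Or.inr (by
    rw [mem_singleton_iff]; linarith))
  have hpos : 0 < |t + z + r| * |t + z - r| :=
    mul_pos (abs_pos.mpr fun h => h2 (by linarith)) (abs_pos.mpr (sub_ne_zero.mpr h1))
  rw [norm_mul, Real.norm_eq_abs, Real.norm_eq_abs]
  calc _ ≤ |deriv humpRadon z| * (2 * Real.pi / √(|t + z + r| * |t + z - r|)) :=
        mul_le_mul_of_nonneg_left (abs_integral_waveVec_mul_conjKernel_le hε α i hpos)
          (abs_nonneg _)
    _ = 2 * Real.pi * (|deriv humpRadon z| / √(|t + z + r| * |t + z - r|)) := by ring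
    _ ≤ 2 * Real.pi * H z := mul_le_mul_of_nonneg_left (hle z h1 h2) (by positivity)

lemma integral_eq_zero_of_antiperiodic {f : ℝ → ℝ} (hf : Function.Antiperiodic f Real.pi) :
    ∫ θ in (0 : ℝ)..2 * Real.pi, f θ = 0 := by
  have hper : Function.Periodic f (2 * Real.pi) := by
    have := hf.periodic_two_mul
    simpa using this
  have h := integral_period_shift hper Real.pi
  simp only [hf _] at h
  rw [intervalIntegral.integral_neg] at h
  linarith

/-- Averaging over all directions, with the weight of the respective component, isolates the
components of the solution: the mixed terms are odd under `ω ↦ -ω`. -/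
lemma integral_planeMoment_eq_of_dAlembert {A : Fin 3 → ℝ → ℝ} {Γ : ℝ → ℝ}
    (hA : ∀ i, Continuous (A i)) (hper : ∀ i θ, A i (θ + Real.pi) = A i θ)
    (hlong : ∀ θ, A 0 θ + Real.cos θ * A 1 θ + Real.sin θ * A 2 θ = Γ θ)
    (htrans : ∀ θ, Real.cos θ * A 2 θ = Real.sin θ * A 1 θ) (i : Fin 3) :
    ∫ θ in (0 : ℝ)..2 * Real.pi, A i θ = ∫ θ in (0 : ℝ)..2 * Real.pi, waveVec θ i * Γ θ := by
  have key : ∀ B : ℝ → ℝ, Continuous B → Function.Antiperiodic B Real.pi →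
      (∀ θ, waveVec θ i * Γ θ = A i θ + B θ) →
      ∫ θ in (0 : ℝ)..2 * Real.pi, A i θ = ∫ θ in (0 : ℝ)..2 * Real.pi, waveVec θ i * Γ θ := by
    intro B hB hanti h
    simp only [h]
    rw [intervalIntegral.integral_add ((hA i).intervalIntegrable _ _) (hB.intervalIntegrable _ _),
      integral_eq_zero_of_antiperiodic hanti, add_zero]
  have h0 := hA 0
  have h1 := hA 1
  have h2 := hA 2
  fin_cases i
  · refine key (fun θ => Real.cos θ * A 1 θ + Real.sin θ * A 2 θ) (by fun_prop)
      (fun θ => ?_) (fun θ => ?_)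
    · simp only [hper, Real.cos_add_pi, Real.sin_add_pi]; ring
    · simp only [waveVec, Fin.zero_eta, Matrix.cons_val_zero, ← hlong]; ring
  · refine key (fun θ => Real.cos θ * A 0 θ) (by fun_prop) (fun θ => ?_) (fun θ => ?_)
    · simp only [hper, Real.cos_add_pi]; ring
    · simp only [waveVec, Fin.mk_one, Matrix.cons_val_one, Matrix.cons_val_zero, ← hlong]
      linear_combination Real.sin θ * htrans θ + A 1 θ * Real.sin_sq_add_cos_sq θ
  · refine key (fun θ => Real.sin θ * A 0 θ) (by fun_prop) (fun θ => ?_) (fun θ => ?_)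
    · simp only [hper, Real.sin_add_pi]; ring
    · simp only [waveVec, Fin.reduceFinMk, Matrix.cons_val, ← hlong]
      linear_combination -Real.cos θ * htrans θ + A 2 θ * Real.sin_sq_add_cos_sq θ

lemma continuous_planeMoment_dirCoord {ε : ℝ} (hε : 0 < ε) {f : Plane → ℝ} (hf : Integrable f)
    (x₀ : Plane) : Continuous fun θ => planeMoment ε f θ (dirCoord θ x₀) := by
  have hdir : Continuous fun θ => dirCoord θ x₀ :=
    continuous_dirCoord.comp (continuous_id.prodMk continuous_const)
  have hpair : Continuous fun θ => (θ, dirCoord θ x₀) := continuous_id.prodMk hdir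
  have h := Continuous.comp (continuous_planeMoment hε hf) hpair
  simpa only [Function.comp_def] using h

lemma planeMoment_dirCoord_add_pi (ε : ℝ) (f : Plane → ℝ) (θ : ℝ) (x₀ : Plane) :
    planeMoment ε f (θ + Real.pi) (dirCoord (θ + Real.pi) x₀) =
      planeMoment ε f θ (dirCoord θ x₀) := by
  rw [dirCoord_add_pi, planeMoment_add_pi]

/-- The solution at time `t` and radius `r = ‖x₀‖` is bounded by any integrable majorant `H` of
`|g' z| / √(|t + z + r| |t + z - r|)`, where `g = humpRadon`. The two exceptional offsets `z` are
those where the square root vanishes. -/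
lemma IsAcousticSolution.ae_abs_le {q : ℝ → Plane → Fin 3 → ℝ}
    (hq : IsAcousticSolution 1 1 cosHumpState q) :
    ∀ᵐ t : ℝ, 0 < t → ∀ (x₀ : Plane) (i : Fin 3) (H : ℝ → ℝ), Integrable H →
      (∀ z, t + z ≠ ‖x₀‖ → t + z ≠ -‖x₀‖ →
        |deriv humpRadon z| / √(|t + z + ‖x₀‖| * |t + z - ‖x₀‖|) ≤ H z) →
      |q t x₀ i| ≤ 1 / (2 * Real.pi) * ∫ z, H z := by
  filter_upwards [hq.ae_forall_planeMoment] with t ht h0 x₀ i H hH hle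
  obtain ⟨hint, hm⟩ := ht h0
  have hqi : ∀ i, Integrable fun x => q t x i := fun i => hint.eval i
  have hqc : ContinuousAt (fun x => q t x i) x₀ := by
    have h1 : ContinuousOn (q t) univ := by
      have := hq.continuousOn.comp (f := fun x : Plane => (t, x)) (s := univ)
        (by fun_prop) (fun x _ => ⟨h0.le, trivial⟩)
      exact this
    exact (continuous_apply i).continuousAt.comp
      (continuousOn_univ.mp h1).continuousAt
  have hlim := (tendsto_poisson_mean (hqi i) hqc).abs
  have hb : |(2 * Real.pi) ^ 2 * q t x₀ i| ≤ 2 * Real.pi * ∫ z, H z := by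
    refine le_of_tendsto hlim (Eventually.of_forall fun n => ?_)
    have hε : (0 : ℝ) < 1 / ((n : ℝ) + 1) := by positivity
    rw [← integral_planeMoment hε (hqi i) x₀, integral_planeMoment_eq_of_dAlembert
      (A := fun i θ => planeMoment (1 / ((n : ℝ) + 1)) (fun x => q t x i) θ (dirCoord θ x₀))
      (fun i => continuous_planeMoment_dirCoord hε (hqi i) x₀)
      (fun i θ => planeMoment_dirCoord_add_pi _ _ _ _)
      (fun θ => (hm n θ (dirCoord θ x₀)).1) (fun θ => (hm n θ (dirCoord θ x₀)).2) i]
    exact abs_integral_waveVec_mul_planeMoment_le hε t x₀ i hH hle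
  have hpi := Real.pi_pos
  rw [abs_mul, abs_of_pos (by positivity : (0 : ℝ) < (2 * Real.pi) ^ 2)] at hb
  rw [one_div, inv_mul_eq_div, le_div_iff₀ (by positivity)]
  have : 2 * Real.pi * (|q t x₀ i| * (2 * Real.pi)) ≤ 2 * Real.pi * ∫ z, H z := by
    linarith
  exact le_of_mul_le_mul_left this (by positivity)

/-! ### The truncated solution vanishes -/

lemma le_of_Ioo_subset_Ioi {b t : ℝ} (h : Ioo (-1 + t) (1 + t) ⊆ Ioi b) : b ≤ t - 1 := by
  by_contra hlt
  have h1 : min b t ∈ Ioo (-1 + t) (1 + t) :=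
    ⟨lt_min (by linarith) (by linarith), (min_le_right _ _).trans_lt (by linarith)⟩
  have h2 : b < min b t := h h1
  exact absurd h2 (not_lt.mpr (min_le_left _ _))

lemma transformedSolution_eq_zero {b t s : ℝ} (hbt : b ≤ t - 1) {ω : Plane} (hω : ‖ω‖ = 1)
    (hs : s ∈ Ioo (-b) b) (i : Fin 3) : transformedSolution t ω s i = 0 := by
  have h1 : humpRadon (s - t) = 0 :=
    humpRadon_of_one_le (le_abs.mpr (Or.inr (by linarith [hs.2])))
  have h2 : humpRadon (s + t) = 0 :=
    humpRadon_of_one_le (le_abs.mpr (Or.inl (by linarith [hs.1])))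
  simp [transformedSolution, radon_cosHump hω, h1, h2]

lemma hilbertTransform_zero (s : ℝ) : hilbertTransform (fun _ => 0) s = 0 := by
  simp only [hilbertTransform, zero_div, integral_zero, mul_zero]
  exact tendsto_const_nhds.limUnder_eq

/-- Once both waves on the Radon side have left the interval `(-b, b)`, nothing is left to
project back. -/
lemma truncatedSolution_eq_zero {b t : ℝ} (hbt : b ≤ t - 1) (x : Plane) (i : Fin 3) :
    truncatedSolution b t x i = 0 := by
  have h : ∀ (ω : Metric.sphere (0 : Plane) 1) (s : ℝ), hilbertTransform
      ((Ioo (-b) b).indicator (deriv fun z : ℝ => transformedSolution t ω z i)) s = 0 := by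
    intro ω s
    have hω : ‖(ω : Plane)‖ = 1 := norm_eq_of_mem_sphere ω
    have h0 : (Ioo (-b) b).indicator (deriv fun z : ℝ => transformedSolution t ω z i) =
        fun _ => 0 := by
      funext z
      refine indicator_apply_eq_zero.mpr fun hz => ?_
      have : (fun z : ℝ => transformedSolution t ω z i) =ᶠ[𝓝 z] fun _ => 0 := by
        filter_upwards [isOpen_Ioo.mem_nhds hz] with y hy
        exact transformedSolution_eq_zero hbt hω hy i
      rw [this.deriv_eq, deriv_const]
    rw [h0, hilbertTransform_zero]
  simp [truncatedSolution, backProjection, h]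

/-! ### Pointwise decay of the solution -/

lemma radonConst_two : radonConst 2 = 2 := by
  have hpi := Real.pi_pos
  have h1 : (((2 : ℕ) : ℝ) - 1) / 2 = 1 / 2 := by norm_num
  have h2 : ((2 : ℕ) : ℝ) / 2 = 1 := by norm_num
  rw [radonConst, h1, h2, Real.Gamma_one, Real.Gamma_one_half_eq, ← Real.sqrt_eq_rpow,
    Real.sqrt_mul (by norm_num), show (4 : ℝ) = 2 ^ 2 by norm_num, Real.sqrt_sq (by norm_num)]
  field_simp

lemma integral_inv_sqrt_left {a b y : ℝ} (hab : a ≤ b) (hby : b ≤ y) :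
    IntegrableOn (fun z => (√|y - z|)⁻¹) (Ioc a b) ∧
      ∫ z in a..b, (√|y - z|)⁻¹ = 2 * √(y - a) - 2 * √(y - b) := by
  have hc : ContinuousOn (fun z => -(2 * √(y - z))) (Icc a b) := by fun_prop
  have hd : ∀ z ∈ Ioo a b, HasDerivAt (fun z => -(2 * √(y - z))) (√|y - z|)⁻¹ z := fun z hz => by
    have hpos : 0 < y - z := by linarith [hz.2]
    have h := ((((hasDerivAt_id z).const_sub y).sqrt hpos.ne').const_mul 2).fun_neg
    refine h.congr_deriv ?_
    rw [abs_of_pos hpos]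
    have := (Real.sqrt_pos.mpr hpos).ne'
    simp only [id_eq]
    field_simp
  have hi := intervalIntegral.integrableOn_deriv_of_nonneg hc hd fun z _ => by positivity
  refine ⟨hi, ?_⟩
  rw [intervalIntegral.integral_eq_sub_of_hasDerivAt_of_le hab hc hd
    ((intervalIntegrable_iff_integrableOn_Ioc_of_le hab).mpr hi)]
  ring

lemma integral_inv_sqrt_right {a b y : ℝ} (hab : a ≤ b) (hya : y ≤ a) :
    IntegrableOn (fun z => (√|y - z|)⁻¹) (Ioc a b) ∧
      ∫ z in a..b, (√|y - z|)⁻¹ = 2 * √(b - y) - 2 * √(a - y) := by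
  have hc : ContinuousOn (fun z => 2 * √(z - y)) (Icc a b) := by fun_prop
  have hd : ∀ z ∈ Ioo a b, HasDerivAt (fun z => 2 * √(z - y)) (√|y - z|)⁻¹ z := fun z hz => by
    have hpos : 0 < z - y := by linarith [hz.1]
    have h := (((hasDerivAt_id z).sub_const y).sqrt hpos.ne').const_mul 2
    refine h.congr_deriv ?_
    rw [abs_sub_comm, abs_of_pos hpos]
    have := (Real.sqrt_pos.mpr hpos).ne'
    simp only [id_eq]
    field_simp
  have hi := intervalIntegral.integrableOn_deriv_of_nonneg hc hd fun z _ => by positivity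
  refine ⟨hi, ?_⟩
  rw [intervalIntegral.integral_eq_sub_of_hasDerivAt_of_le hab hc hd
    ((intervalIntegrable_iff_integrableOn_Ioc_of_le hab).mpr hi)]

lemma integral_inv_sqrt_le {y : ℝ} (hy : -1 < y) :
    IntegrableOn (fun z => (√|y - z|)⁻¹) (Ioc (-1) 1) ∧
      ∫ z in (-1 : ℝ)..1, (√|y - z|)⁻¹ ≤ 4 * √2 / √(y + 1) := by
  have hy1 : 0 < y + 1 := by linarith
  have hs := Real.sqrt_pos.mpr hy1
  have hs2 := Real.sq_sqrt hy1.le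
  have h2 := Real.sq_sqrt (show (0 : ℝ) ≤ 2 by norm_num)
  have h2' : 1 ≤ √2 := Real.one_le_sqrt.mpr (by norm_num)
  rcases le_or_gt 1 y with h | h
  · obtain ⟨hi, he⟩ := integral_inv_sqrt_left (a := -1) (b := 1) (by norm_num) h
    refine ⟨hi, ?_⟩
    rw [he, le_div_iff₀ hs, sub_neg_eq_add]
    have h3 := Real.sq_sqrt (show 0 ≤ y - 1 by linarith)
    have h4 : √(y - 1) ≤ √(y + 1) := Real.sqrt_le_sqrt (by linarith)
    nlinarith [Real.sqrt_nonneg (y - 1)]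
  · obtain ⟨hi1, he1⟩ := integral_inv_sqrt_left (a := -1) (b := y) (y := y) hy.le le_rfl
    obtain ⟨hi2, he2⟩ := integral_inv_sqrt_right (a := y) (b := 1) (y := y) h.le le_rfl
    refine ⟨by rw [← Ioc_union_Ioc_eq_Ioc hy.le h.le]; exact hi1.union hi2, ?_⟩
    rw [← intervalIntegral.integral_add_adjacent_intervals
      ((intervalIntegrable_iff_integrableOn_Ioc_of_le hy.le).mpr hi1)
      ((intervalIntegrable_iff_integrableOn_Ioc_of_le h.le).mpr hi2), he1, he2, le_div_iff₀ hs]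
    simp only [sub_self, Real.sqrt_zero, mul_zero, sub_zero, sub_neg_eq_add]
    have h3 := Real.sq_sqrt (show 0 ≤ 1 - y by linarith)
    -- `√(1 + y) + √(1 - y) ≤ 2` and `√(1 + y) ≤ √2`
    have h4 : √(y + 1) + √(1 - y) ≤ 2 := by
      nlinarith [sq_nonneg (√(y + 1) - √(1 - y)), Real.sqrt_nonneg (1 - y)]
    have h5 : √(y + 1) ≤ √2 := Real.sqrt_le_sqrt (by linarith)
    nlinarith [Real.sqrt_nonneg (1 - y)]

section
variable {q : ℝ → Plane → Fin 3 → ℝ}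

/-- Behind the wave the weight in `ae_abs_le` is bounded by the inverse distance to the light
cones of the support of the data. In front of the outgoing wave and on it, it has an integrable
singularity, and the derivative of the Radon transform is bounded. -/
lemma IsAcousticSolution.ae_abs_le_div (hq : IsAcousticSolution 1 1 cosHumpState q) :
    ∀ᵐ t : ℝ, 1 < t → ∀ (x : Plane) (i : Fin 3), t - ‖x‖ - 1 ≠ 0 →
      |q t x i| ≤ √6 * Real.pi / 3 * (∫ z, |deriv humpRadon z|) / |t - ‖x‖ - 1| := by
  have hV := integral_abs_deriv_humpRadon_ge
  set V := ∫ z, |deriv humpRadon z| with hVdef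
  have hpi := Real.pi_gt_three
  have h23 : √6 = √2 * √3 := by rw [← Real.sqrt_mul (by norm_num)]; norm_num
  have h2 : 1.4 < √2 := Real.lt_sqrt_of_sq_lt (by norm_num)
  have h3 : 1.7 < √3 := Real.lt_sqrt_of_sq_lt (by norm_num)
  have hout : ∀ z, z ∉ Icc (-1 : ℝ) 1 → |deriv humpRadon z| = 0 := fun z hz => by
    rw [deriv_humpRadon_of_one_le (not_le.mp fun h => hz (abs_le.mp h)).le, abs_zero]
  filter_upwards [hq.ae_abs_le] with t ht h1 x i hx
  have ht' := ht (by linarith) x i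
  set r := ‖x‖
  have hr : 0 ≤ r := norm_nonneg x
  rcases lt_or_gt_of_ne hx with hlt | hgt
  · -- outside: `D` is the distance of `r` from the trailing edge of the wave
    set D := r - t + 1 with hD
    have hD0 : 0 < D := by linarith
    have hsD := Real.sqrt_pos.mpr hD0
    obtain ⟨hi, hle⟩ := integral_inv_sqrt_le (y := D - 1) (by linarith)
    rw [sub_add_cancel] at hle
    let H : ℝ → ℝ := (Ioc (-1 : ℝ) 1).indicator
      fun z => 2 * Real.pi / √D * (√|D - 1 - z|)⁻¹
    have hH : Integrable H := (integrable_indicator_iff measurableSet_Ioc).mpr (hi.const_mul _)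
    have hHle : ∫ z, H z ≤ 2 * Real.pi * (4 * √2) / D := by
      rw [integral_indicator measurableSet_Ioc, integral_const_mul,
        ← intervalIntegral.integral_of_le (by norm_num)]
      calc _ ≤ 2 * Real.pi / √D * (4 * √2 / √D) :=
            mul_le_mul_of_nonneg_left hle (by positivity)
        _ = 2 * Real.pi * (4 * √2) / (√D * √D) := by field_simp
        _ = _ := by rw [Real.mul_self_sqrt hD0.le]
    have hb := ht' H hH fun z hz1 _ => by
      by_cases hz : z ∈ Ioc (-1 : ℝ) 1
      · simp only [H]
        rw [indicator_of_mem hz, Real.sqrt_mul (abs_nonneg _)]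
        have e1 : |t + z - r| = |D - 1 - z| := by
          rw [abs_sub_comm]; congr 1; rw [hD]; ring
        have e2 : √D ≤ √|t + z + r| := by
          refine Real.sqrt_le_sqrt ((le_abs_self _).trans' ?_)
          linarith [hz.1]
        have e3 : 0 < √|D - 1 - z| := by
          rw [← e1]
          exact Real.sqrt_pos.mpr (abs_pos.mpr (sub_ne_zero.mpr hz1))
        rw [e1]
        calc |deriv humpRadon z| / (√|t + z + r| * √|D - 1 - z|)
            ≤ 2 * Real.pi / (√D * √|D - 1 - z|) := by
              gcongr
              exact abs_deriv_humpRadon_le z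
          _ = _ := by field_simp
      · have : |deriv humpRadon z| = 0 := by
          rcases not_and_or.mp hz with h | h
          · rw [deriv_humpRadon_of_one_le (le_abs.mpr (Or.inr (by linarith))), abs_zero]
          · exact hout z fun h' => h h'.2
        simp only [H]
        rw [this, zero_div, indicator_of_notMem hz]
    have hD' : |t - r - 1| = D := by rw [abs_of_neg hlt, hD]; ring
    rw [hD']
    calc |q t x i| ≤ 1 / (2 * Real.pi) * (2 * Real.pi * (4 * √2) / D) :=
          hb.trans (mul_le_mul_of_nonneg_left hHle (by positivity))
      _ = 4 * √2 / D := by field_simp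
      _ ≤ √6 * Real.pi / 3 * V / D := by
          refine div_le_div_of_nonneg_right ?_ hD0.le
          rw [h23]
          have h4 : 5.1 ≤ √3 * Real.pi := by nlinarith
          have h5 : 13.6 ≤ √3 * Real.pi * V := by nlinarith
          nlinarith
  · -- inside: all `t + z` with `|z| ≤ 1` are at distance at least `d` from `r` and `-r`
    set d := t - r - 1 with hd
    have hd0 : 0 < d := hgt
    have hb := ht' (fun z => |deriv humpRadon z| / d)
      (integrable_deriv_humpRadon.abs.div_const d) fun z _ _ => by
        by_cases hz : z ∈ Icc (-1 : ℝ) 1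
        · have e1 : d ≤ |t + z + r| := (le_abs_self _).trans' (by linarith [hz.1])
          have e2 : d ≤ |t + z - r| := (le_abs_self _).trans' (by linarith [hz.1])
          have e3 : d ≤ √(|t + z + r| * |t + z - r|) := by
            refine Real.le_sqrt_of_sq_le ?_
            rw [pow_two]
            exact mul_le_mul e1 e2 hd0.le (abs_nonneg _)
          gcongr
        · rw [hout z hz, zero_div, zero_div]
    rw [integral_div, ← hVdef] at hb
    rw [abs_of_pos hd0]
    refine hb.trans ?_
    rw [← mul_div_assoc]
    refine div_le_div_of_nonneg_right (mul_le_mul_of_nonneg_right ?_ (by linarith)) hd0.le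
    have h4 : 1 / (2 * Real.pi) ≤ 1 := by
      rw [div_le_one (by positivity)]; linarith
    rw [h23]
    have h5 : 1 ≤ √2 * √3 := by nlinarith
    nlinarith

/-- By continuity in time the estimate holds at all times. -/
lemma IsAcousticSolution.abs_le_div (hq : IsAcousticSolution 1 1 cosHumpState q) {t : ℝ}
    (ht : 1 < t) {x : Plane} (hx : t - ‖x‖ - 1 ≠ 0) (i : Fin 3) :
    |q t x i| ≤ √6 * Real.pi / 3 * (∫ z, |deriv humpRadon z|) / |t - ‖x‖ - 1| := by
  set K := √6 * Real.pi / 3 * (∫ z, |deriv humpRadon z|)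
  let U : Set ℝ := {s | 1 < s ∧ s - ‖x‖ - 1 ≠ 0}
  have hU : IsOpen U := (isOpen_lt continuous_const continuous_id).inter
    (isOpen_ne_fun (by fun_prop) continuous_const)
  obtain ⟨S, hS, hgood⟩ : ∃ S : Set ℝ, Dense S ∧ ∀ s ∈ S, 1 < s → ∀ (x : Plane) (i : Fin 3),
      s - ‖x‖ - 1 ≠ 0 → |q s x i| ≤
        √6 * Real.pi / 3 * (∫ z, |deriv humpRadon z|) / |s - ‖x‖ - 1| :=
    ⟨_, Measure.dense_of_ae hq.ae_abs_le_div, fun _ h => h⟩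
  have hmem := hS.open_subset_closure_inter hU (show t ∈ U from ⟨ht, hx⟩)
  have hne := mem_closure_iff_nhdsWithin_neBot.mp hmem
  have hcq : ContinuousAt (fun s => |q s x i|) t := by
    have h1 : ContinuousAt (fun z : ℝ × Plane => q z.1 z.2) (t, x) :=
      hq.continuousOn.continuousAt (prod_mem_nhds (Ici_mem_nhds (by linarith)) univ_mem)
    have h2 : ContinuousAt (fun s : ℝ => q s x) t :=
      ContinuousAt.comp (f := fun s : ℝ => (s, x)) h1 (by fun_prop)
    exact ((continuous_apply i).continuousAt.comp h2).abs
  have hcK : ContinuousAt (fun s => K / |s - ‖x‖ - 1|) t :=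
    continuousAt_const.div (by fun_prop) (abs_ne_zero.mpr hx)
  refine le_of_tendsto_of_tendsto (hcq.mono_left (nhdsWithin_le_nhds (s := U ∩ S)))
    (hcK.mono_left nhdsWithin_le_nhds) ?_
  filter_upwards [self_mem_nhdsWithin] with s hs
  exact hgood s hs.2 hs.1.1 x i hs.1.2
end

/-! ### The error estimate -/

theorem mainTheorem1 (q : ℝ → Plane → Fin 3 → ℝ)
    (hq : IsAcousticSolution 1 1 cosHumpState q) (b : ℝ) (hb : 0 < b) :
    (∀ t : ℝ, Set.Ioo (-1 + t) (1 + t) ⊆ Set.Ioi b → ∀ x : Plane, t - ‖x‖ - 1 ≠ 0 →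
      ∀ ω : Plane, ‖ω‖ = 1 →
        ∑ i : Fin 3, |q t x i - truncatedSolution b t x i| ≤
          2 * Real.sqrt 6 * Real.pi / (radonConst 2 * |t - ‖x‖ - 1|) *
            ∫ z : ℝ, |deriv (fun s : ℝ => radon cosHump ω s) z|) ∧
    (∀ R : ℝ, ∃ C T : ℝ, 0 < T ∧ ∀ t : ℝ, T ≤ t → ∀ x : Plane, ‖x‖ ≤ R →
      ∑ i : Fin 3, |q t x i - truncatedSolution b t x i| ≤ C / t) := by
  have key : ∀ t : ℝ, b ≤ t - 1 → ∀ x : Plane, t - ‖x‖ - 1 ≠ 0 →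
      ∑ i : Fin 3, |q t x i - truncatedSolution b t x i| ≤
        √6 * Real.pi * (∫ z, |deriv humpRadon z|) / |t - ‖x‖ - 1| := by
    intro t hbt x hx
    have ht : 1 < t := by linarith
    simp only [truncatedSolution_eq_zero hbt, sub_zero]
    calc ∑ i : Fin 3, |q t x i|
        ≤ ∑ _i : Fin 3, √6 * Real.pi / 3 * (∫ z, |deriv humpRadon z|) / |t - ‖x‖ - 1| :=
          Finset.sum_le_sum fun i _ => hq.abs_le_div ht hx i
      _ = _ := by
          rw [Finset.sum_const, Finset.card_univ, Fintype.card_fin, nsmul_eq_mul]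
          push_cast
          ring
  constructor
  · intro t hsub x hx ω hω
    refine (key t (le_of_Ioo_subset_Ioi hsub) x hx).trans (le_of_eq ?_)
    simp only [radon_cosHump hω]
    rw [radonConst_two]
    have := abs_pos.mpr hx
    field_simp
  · intro R
    set K := √6 * Real.pi * ∫ z, |deriv humpRadon z|
    have hK : 0 ≤ K := mul_nonneg (by positivity) (integral_nonneg fun _ => abs_nonneg _)
    refine ⟨2 * K, 2 * |R| + 2 + b, by positivity, fun t ht x hx => ?_⟩
    have hR := le_abs_self R
    have hR0 := abs_nonneg R
    -- the distance to the wave is at least `t / 2` for such times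
    have hd : t / 2 ≤ t - ‖x‖ - 1 := by linarith
    have ht0 : 0 < t := by linarith
    have hd0 : 0 < t - ‖x‖ - 1 := by linarith
    refine (key t (by linarith) x hd0.ne').trans ?_
    rw [abs_of_pos hd0]
    calc K / (t - ‖x‖ - 1) ≤ K / (t / 2) := by gcongr
      _ = 2 * K / t := by field_simp
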